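/- Let $d\ge 1$ be an integer and let $\mathcal F_d$ be the set of upper semi-continuous log-concave probability densities $f:\mathbb R^d\to[0,\infty)$ with respect to Lebesgue measure (where $\log 0=-\infty$, so $f$ may vanish). For $f\in\mathcal F_d$ put $\mu_f=\int x f(x)\,dx$ and $\Sigma_f=\int (x-\mu_f)(x-\mu_f)^{T} f(x)\,dx$, and write $\lambda_{\min}(\Sigma_f)$, $\lambda_{\max}(\Sigma_f)$ for the smallest and largest eigenvalues of $\Sigma_f$. For $\xi\ge 0$ and $\eta\in(0,1)$ let $$\tilde{\mathcal F}_d^{\xi,\eta}=\{f\in\mathcal F_d:\ \|\mu_f\|\le\xi \text{ and } 1-\eta\le\lambda_{\min}(\Sigma_f)\le\lambda_{\max}(\Sigma_f)\le 1+\eta\},$$ where $\|\cdot\|$ is the Euclidean norm. (a) There exist $A_{0,d},B_{0,d}>0$, depending only on $d$, such that for every $\xi\ge 0$, every $\eta\in(0,1)$ and every $x\in\mathbb R^d$, $$\sup_{f\in\tilde{\mathcal F}_d^{\xi,\eta}} f(x)\le (1-\eta)^{-d/2}\exp\Bigl\{-\frac{A_{0,d}\|x\|}{(1+\eta)^{1/2}}+\frac{A_{0,d}\,\xi}{(1+\eta)^{1/2}}+B_{0,d}\Bigr\}.$$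 (b) For every $\xi\ge 0$ and $\eta\in(0,1)$ with $\xi<(1-\eta)^{1/2}/4$, and every $x\in\mathbb R^d$ with $\|x\|\le(1-\eta)^{1/2}/4-\xi$, $$\inf_{f\in\tilde{\mathcal F}_d^{\xi,\eta}} f(x)>0.$$ -/

import Mathlib

namespace LogConcaveEnvelope

open MeasureTheory

/-- A nonnegative real function `f` is log-concave: `log f`, with `log 0 = -∞`, is concave.
The condition is written multiplicatively, with both weights positive, so that zeros of `f`
are handled correctly (`0 ^ a = 0` for `a > 0`). -/
def IsLogConcave {d : ℕ} (f : EuclideanSpace ℝ (Fin d) → ℝ) : Prop :=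
  (∀ x, 0 ≤ f x) ∧
    ∀ x y : EuclideanSpace ℝ (Fin d), ∀ a b : ℝ, 0 < a → 0 < b → a + b = 1 →
      f x ^ a * f y ^ b ≤ f (a • x + b • y)

/-- `𝓕_d`: the upper semi-continuous log-concave probability densities on `ℝ^d`
with respect to Lebesgue measure. -/
def logConcaveDensities (d : ℕ) : Set (EuclideanSpace ℝ (Fin d) → ℝ) :=
  {f | IsLogConcave f ∧ UpperSemicontinuous f ∧ Integrable f ∧ ∫ x, f x = 1}

/-- The mean vector `μ_f = ∫ x f(x) dx`. -/
noncomputable def mean {d : ℕ} (f : EuclideanSpace ℝ (Fin d) → ℝ) :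
    EuclideanSpace ℝ (Fin d) :=
  ∫ x, f x • x

/-- The covariance matrix `Σ_f = ∫ (x - μ_f)(x - μ_f)ᵀ f(x) dx`, entry by entry. -/
noncomputable def covMatrix {d : ℕ} (f : EuclideanSpace ℝ (Fin d) → ℝ) :
    Matrix (Fin d) (Fin d) ℝ :=
  Matrix.of fun i j => ∫ x, (x i - mean f i) * (x j - mean f j) * f x

/-- The set of real eigenvalues of a real square matrix. It is finite, and it is nonempty when
the matrix is symmetric and `d ≥ 1`. -/
def eigenvalueSet {d : ℕ} (M : Matrix (Fin d) (Fin d) ℝ) : Set ℝ :=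
  {l | Module.End.HasEigenvalue (Matrix.toLin' M) l}

/-- The smallest eigenvalue of a symmetric matrix (of size `d ≥ 1`). -/
noncomputable def lambdaMin {d : ℕ} (M : Matrix (Fin d) (Fin d) ℝ) : ℝ :=
  sInf (eigenvalueSet M)

/-- The largest eigenvalue of a symmetric matrix (of size `d ≥ 1`). -/
noncomputable def lambdaMax {d : ℕ} (M : Matrix (Fin d) (Fin d) ℝ) : ℝ :=
  sSup (eigenvalueSet M)

/-- The class of `f ∈ 𝓕_d` with `‖μ_f‖ ≤ ξ` and
`1 - η ≤ λ_min(Σ_f) ≤ λ_max(Σ_f) ≤ 1 + η`. -/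
def nearIsotropic (d : ℕ) (ξ η : ℝ) : Set (EuclideanSpace ℝ (Fin d) → ℝ) :=
  {f | f ∈ logConcaveDensities d ∧ ‖mean f‖ ≤ ξ ∧
    1 - η ≤ lambdaMin (covMatrix f) ∧ lambdaMax (covMatrix f) ≤ 1 + η}

end LogConcaveEnvelope

/-! Upper bound. A density with variance at least ρ² = 1 - η in every direction cannot peak: its
superlevel set at the fraction 2^(-(d+3)) of f(x₀) must be wide about x₀ in every direction, or the
second moment in a thin direction would drop below ρ². That set is convex, so it contains a large
parallelepiped, and Markov's inequality bounds f(x₀) by a dimensional multiple of ρ^(-d)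
(`HasMomentBounds.le_supConst`). For the decay, most of the mass lies in a ball of radius of order
√(d(1 + η)) about the mean. Contracting that ball towards a far point y carries it outside itself,
where too much mass would land unless f(y) were exponentially small (`HasMomentBounds.le_mul_exp`).

Lower bound. If f(x) < ε, Hahn–Banach gives a half-space with x on its boundary where f < ε; by the
exponential envelope it carries almost no mass or second moment. When ‖x - m‖ ≤ ρ/4, this forces φ =
ρ/4 - ⟪u, · - m⟫ to be essentially nonnegative under f, with mean ρ/4 and second moment at least ρ²
+ ρ²/16. This contradicts the reverse Hölder inequality E φ² ≤ 4 (E φ)²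
(`integral_mul_integral_posPart_sq_le`), a consequence of Prékopa–Leindler.
`HasMomentBounds.lt_integral_halfspace` makes the contradiction quantitative, uniformly in f. -/

namespace LogConcaveEnvelope

open MeasureTheory Set
open scoped ENNReal RealInnerProductSpace Matrix

/-! ### Brunn–Minkowski and Prékopa–Leindler on the line -/

/-- The one-dimensional Brunn–Minkowski inequality for compact sets, in midpoint form. -/
theorem volume_add_le_of_midpoint_mem_of_isCompact {A B C : Set ℝ} (hA : IsCompact A)
    (hB : IsCompact B) (hA0 : A.Nonempty) (hB0 : B.Nonempty)
    (h : ∀ x ∈ A, ∀ y ∈ B, (2⁻¹ : ℝ) * (x + y) ∈ C) :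
    volume A + volume B ≤ 2 * volume C := by
  obtain ⟨p, hpA, hp⟩ := hA.exists_isGreatest hA0
  obtain ⟨q, hqB, hq⟩ := hB.exists_isLeast hB0
  set D : Set ℝ := (fun z : ℝ => (2⁻¹ : ℝ) * z) ⁻¹' C with hD
  have hDC : volume D = 2 * volume C := by
    rw [hD, Real.volume_preimage_mul_left (by norm_num)]
    norm_num
  -- The translates A + q and p + B both lie in D = 2C, on either side of p + q, which is their only
  -- common point; deleting q from B makes them disjoint at no cost.
  have h1 : volume A ≤ volume (D ∩ Iic (p + q)) := by
    rw [← measure_preimage_add_right volume (-q) A]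
    refine measure_mono fun z hz => ⟨?_, ?_⟩
    · have := h _ hz q hqB
      simpa [hD] using this
    · have := hp hz
      simp only [mem_Iic]; linarith
  have h2 : volume B ≤ volume (D \ Iic (p + q)) := by
    rw [← measure_sdiff_null (s := B) (t := {q}) (by simp),
      ← measure_preimage_add_right volume (-p) (B \ {q})]
    refine measure_mono fun z hz => ⟨?_, ?_⟩
    · have := h p hpA _ hz.1
      simpa [hD] using this
    · have h3 := hq hz.1
      have h4 : z + -p ≠ q := hz.2
      have h5 := lt_of_le_of_ne h3 h4.symm
      simp only [mem_Iic, not_le]; linarith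
  rw [← hDC, ← measure_inter_add_sdiff D (measurableSet_Iic (a := p + q))]
  exact add_le_add h1 h2

/-- The one-dimensional Brunn–Minkowski inequality, in midpoint form. -/
theorem volume_add_le_of_midpoint_mem {A B C : Set ℝ} (hA : MeasurableSet A)
    (hB : MeasurableSet B) (hA0 : A.Nonempty) (hB0 : B.Nonempty)
    (h : ∀ x ∈ A, ∀ y ∈ B, (2⁻¹ : ℝ) * (x + y) ∈ C) :
    volume A + volume B ≤ 2 * volume C := by
  obtain ⟨a, ha⟩ := hA0
  obtain ⟨b, hb⟩ := hB0
  have key : ∀ K ⊆ A, IsCompact K → ∀ L ⊆ B, IsCompact L →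
      volume K + volume L ≤ 2 * volume C := by
    intro K hKA hK L hLB hL
    -- K or L may be empty, so fixed points of A and B are inserted.
    calc volume K + volume L ≤ volume (insert a K) + volume (insert b L) := by gcongr <;> simp
      _ ≤ 2 * volume C := volume_add_le_of_midpoint_mem_of_isCompact (hK.insert a) (hL.insert b)
          (insert_nonempty _ _) (insert_nonempty _ _) fun x hx y hy =>
            h x (insert_subset ha hKA hx) y (insert_subset hb hLB hy)
  have key2 : ∀ L ⊆ B, IsCompact L → volume A + volume L ≤ 2 * volume C := by
    intro L hLB hL
    have : volume A ≤ 2 * volume C - volume L := by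
      rw [hA.measure_eq_iSup_isCompact]
      exact iSup₂_le fun K hKA => iSup_le fun hK =>
        ENNReal.le_sub_of_add_le_right hL.measure_lt_top.ne (key K hKA hK L hLB hL)
    calc volume A + volume L ≤ (2 * volume C - volume L) + volume L := by gcongr
      _ = 2 * volume C := tsub_add_cancel_of_le
          ((le_add_self).trans (key ∅ (empty_subset _) isCompact_empty L hLB hL))
  by_cases hAt : volume A = ∞
  · have := key2 ∅ (empty_subset _) isCompact_empty
    rw [hAt] at this
    simp only [measure_empty, add_zero, top_le_iff] at this
    simp [this]
  have : volume B ≤ 2 * volume C - volume A := by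
    rw [hB.measure_eq_iSup_isCompact]
    exact iSup₂_le fun L hLB => iSup_le fun hL =>
      ENNReal.le_sub_of_add_le_left hAt (key2 L hLB hL)
  calc volume A + volume B ≤ volume A + (2 * volume C - volume A) := by gcongr
    _ = 2 * volume C := add_tsub_cancel_of_le
        ((le_self_add).trans (key2 ∅ (empty_subset _) isCompact_empty))

theorem lintegral_eq_lintegral_volume_lt_toReal {f : ℝ → ℝ≥0∞} (hf : Measurable f)
    (h1 : ∀ x, f x ≤ 1) :
    ∫⁻ x, f x = ∫⁻ t in Ioi (0 : ℝ), volume {x | t < (f x).toReal} := by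
  rw [← lintegral_eq_lintegral_meas_lt volume (ae_of_all _ fun x => ENNReal.toReal_nonneg)
    hf.ennreal_toReal.aemeasurable]
  exact lintegral_congr fun x =>
    (ENNReal.ofReal_toReal ((h1 x).trans_lt ENNReal.one_lt_top).ne).symm

/-- The one-dimensional Prékopa–Leindler inequality for functions with supremum one, in its
additive form. -/
theorem lintegral_add_le_of_iSup_eq_one {f g h : ℝ → ℝ≥0∞} (hf : Measurable f)
    (hg : Measurable g) (hh : Measurable h) (hf1 : ⨆ x, f x = 1) (hg1 : ⨆ x, g x = 1)
    (hh1 : ∀ x, h x ≤ 1) (H : ∀ x y, f x * g y ≤ h ((2⁻¹ : ℝ) * (x + y)) ^ 2) :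
    (∫⁻ x, f x) + ∫⁻ x, g x ≤ 2 * ∫⁻ x, h x := by
  have hfl : ∀ x, f x ≤ 1 := fun x => hf1 ▸ le_iSup f x
  have hgl : ∀ x, g x ≤ 1 := fun x => hg1 ▸ le_iSup g x
  rw [lintegral_eq_lintegral_volume_lt_toReal hf hfl,
    lintegral_eq_lintegral_volume_lt_toReal hg hgl,
    lintegral_eq_lintegral_volume_lt_toReal hh hh1,
    ← lintegral_const_mul' _ _ (by norm_num), ← lintegral_add_left]
  · refine setLIntegral_mono' measurableSet_Ioi fun t (ht : 0 < t) => ?_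
    have hne : ∀ {k : ℝ → ℝ≥0∞}, (⨆ x, k x = 1) → t < 1 → {x | t < (k x).toReal}.Nonempty := by
      intro k hk ht1
      have : ENNReal.ofReal t < ⨆ x, k x := by
        rw [hk]; exact ENNReal.ofReal_lt_one.mpr ht1
      obtain ⟨x, hx⟩ := lt_iSup_iff.mp this
      exact ⟨x, (ENNReal.ofReal_lt_iff_lt_toReal ht.le
        ((hk ▸ le_iSup k x).trans_lt ENNReal.one_lt_top).ne).mp hx⟩
    by_cases ht1 : t < 1
    · refine volume_add_le_of_midpoint_mem (measurableSet_lt measurable_const hf.ennreal_toReal)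
        (measurableSet_lt measurable_const hg.ennreal_toReal) (hne hf1 ht1) (hne hg1 ht1) ?_
      intro x hx y hy
      simp only [mem_ofPred_eq] at hx hy ⊢
      have h2 : (f x).toReal * (g y).toReal ≤ (h ((2⁻¹ : ℝ) * (x + y))).toReal ^ 2 := by
        rw [← ENNReal.toReal_mul, ← ENNReal.toReal_pow]
        exact ENNReal.toReal_mono
          (ENNReal.pow_ne_top ((hh1 _).trans_lt ENNReal.one_lt_top).ne) (H x y)
      nlinarith [ENNReal.toReal_nonneg (a := h ((2⁻¹ : ℝ) * (x + y)))]
    · have hem : ∀ {k : ℝ → ℝ≥0∞}, (∀ x, k x ≤ 1) → {x | t < (k x).toReal} = ∅ := by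
        intro k hk
        refine eq_empty_of_forall_notMem fun x hx => ?_
        have h3 : (k x).toReal ≤ 1 := by simpa using ENNReal.toReal_mono ENNReal.one_ne_top (hk x)
        exact ht1 (lt_of_lt_of_le hx h3)
      simp [hem hfl, hem hgl]
  · exact Antitone.measurable fun s t hst => measure_mono fun x hx => lt_of_le_of_lt hst hx

theorem ennreal_four_mul_le_sq_add (a b : ℝ≥0∞) : 4 * (a * b) ≤ (a + b) ^ 2 := by
  rcases le_total a b with h | h
  · obtain ⟨c, rfl⟩ := exists_add_of_le h
    calc 4 * (a * (a + c)) ≤ 4 * (a * (a + c)) + c ^ 2 := le_self_add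
      _ = _ := by ring
  · obtain ⟨c, rfl⟩ := exists_add_of_le h
    calc 4 * ((b + c) * b) ≤ 4 * ((b + c) * b) + c ^ 2 := le_self_add
      _ = _ := by ring

/-- Rescaling f and g to supremum one reduces this to the additive form; AM–GM then turns the sum
into a product. -/
theorem prekopaLeindler_real_of_bounded {f g h : ℝ → ℝ≥0∞} (hf : Measurable f)
    (hg : Measurable g) (hh : Measurable h) (hfb : ⨆ x, f x ≠ ∞) (hgb : ⨆ x, g x ≠ ∞)
    (H : ∀ x y, f x * g y ≤ h ((2⁻¹ : ℝ) * (x + y)) ^ 2) :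
    (∫⁻ x, f x) * ∫⁻ x, g x ≤ (∫⁻ x, h x) ^ 2 := by
  set α := ⨆ x, f x with hα
  set β := ⨆ x, g x with hβ
  by_cases hα0 : α = 0
  · have : ∀ x, f x = 0 := fun x => by simpa [hα0] using (hα ▸ le_iSup f x : f x ≤ α)
    simp [this]
  by_cases hβ0 : β = 0
  · have : ∀ x, g x = 0 := fun x => by simpa [hβ0] using (hβ ▸ le_iSup g x : g x ≤ β)
    simp [this]
  set γ : ℝ≥0∞ := (α * β) ^ (2⁻¹ : ℝ) with hγ
  have hγ2 : γ ^ 2 = α * β := by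
    rw [hγ, ← ENNReal.rpow_natCast, ← ENNReal.rpow_mul]; norm_num
  have hγ2' : (γ⁻¹) ^ 2 = α⁻¹ * β⁻¹ := by
    rw [← ENNReal.inv_pow, hγ2, ENNReal.mul_inv (Or.inl hα0) (Or.inl hfb)]
  -- Cutting the rescaled h at 1 preserves the midpoint hypothesis, as the rescaled f and g are at
  -- most 1.
  have key := lintegral_add_le_of_iSup_eq_one (f := fun x => α⁻¹ * f x) (g := fun x => β⁻¹ * g x)
    (h := fun x => min (γ⁻¹ * h x) 1) (hf.const_mul _) (hg.const_mul _)
    ((hh.const_mul _).min measurable_const)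
    (by rw [← ENNReal.mul_iSup, ← hα, ENNReal.inv_mul_cancel hα0 hfb])
    (by rw [← ENNReal.mul_iSup, ← hβ, ENNReal.inv_mul_cancel hβ0 hgb])
    (fun x => min_le_right _ _) (by
      intro x y
      have e : α⁻¹ * f x * (β⁻¹ * g y) = α⁻¹ * β⁻¹ * (f x * g y) := by ring
      rcases min_choice (γ⁻¹ * h ((2⁻¹ : ℝ) * (x + y))) 1 with h1 | h1
      · rw [h1, mul_pow, hγ2', e]
        gcongr
        exact H x y
      · rw [h1, one_pow]
        calc α⁻¹ * f x * (β⁻¹ * g y) ≤ α⁻¹ * α * (β⁻¹ * β) := by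
              gcongr
              · exact le_iSup f x
              · exact le_iSup g y
          _ = 1 := by rw [ENNReal.inv_mul_cancel hα0 hfb, ENNReal.inv_mul_cancel hβ0 hgb, one_mul])
  rw [lintegral_const_mul _ hf, lintegral_const_mul _ hg] at key
  have key2 : ∫⁻ x, min (γ⁻¹ * h x) 1 ≤ γ⁻¹ * ∫⁻ x, h x := by
    rw [← lintegral_const_mul _ hh]
    exact lintegral_mono fun x => min_le_left _ _
  set F := ∫⁻ x, f x
  set G := ∫⁻ x, g x
  set K := ∫⁻ x, h x
  have h4 : 4 * (α⁻¹ * β⁻¹ * (F * G)) ≤ 4 * (α⁻¹ * β⁻¹ * K ^ 2) := by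
    calc 4 * (α⁻¹ * β⁻¹ * (F * G)) = 4 * (α⁻¹ * F * (β⁻¹ * G)) := by ring
      _ ≤ (α⁻¹ * F + β⁻¹ * G) ^ 2 := ennreal_four_mul_le_sq_add _ _
      _ ≤ (2 * (γ⁻¹ * K)) ^ 2 := by gcongr; exact key.trans (by gcongr)
      _ = 4 * (γ⁻¹ ^ 2 * K ^ 2) := by ring
      _ = _ := by rw [hγ2']
  rw [ENNReal.mul_le_mul_iff_right (by norm_num) (by norm_num),
    ENNReal.mul_le_mul_iff_right (by simp [hfb, hgb]) (by simp [ENNReal.mul_eq_top, hα0, hβ0])] at h4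
  exact h4

/-! ### Prékopa–Leindler in higher dimension -/

/-- The Prékopa–Leindler inequality, in midpoint form, holds on the measure space `V`. -/
def PrekopaLeindler (V : Type*) [AddCommGroup V] [Module ℝ V] [MeasureSpace V] : Prop :=
  ∀ f g h : V → ℝ≥0∞, Measurable f → Measurable g → Measurable h →
    (∀ x y, f x * g y ≤ h ((2⁻¹ : ℝ) • (x + y)) ^ 2) →
    (∫⁻ x, f x) * ∫⁻ x, g x ≤ (∫⁻ x, h x) ^ 2

theorem prekopaLeindler_real : PrekopaLeindler ℝ := by
  intro f g h hf hg hh H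
  have trunc : ∀ {k : ℝ → ℝ≥0∞}, Measurable k →
      ∫⁻ x, k x = ⨆ n : ℕ, ∫⁻ x, min (k x) n := by
    intro k hk
    rw [← lintegral_iSup (fun n => hk.min measurable_const)
      (fun m n hmn x => min_le_min_left _ (by exact_mod_cast hmn))]
    refine lintegral_congr fun x => ?_
    rw [← inf_iSup_eq, ENNReal.iSup_natCast, inf_top_eq]
  have bdd : ∀ (k : ℝ → ℝ≥0∞) (n : ℕ), ⨆ x, min (k x) n ≠ ∞ := fun k n =>
    ((iSup_le fun x => min_le_right _ _).trans_lt (ENNReal.natCast_lt_top n)).ne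
  rw [trunc hf, trunc hg, ENNReal.iSup_mul]
  refine iSup_le fun m => ?_
  rw [ENNReal.mul_iSup]
  refine iSup_le fun n => ?_
  refine prekopaLeindler_real_of_bounded (hf.min measurable_const) (hg.min measurable_const) hh
    (bdd f m) (bdd g n) fun x y => ?_
  exact le_trans (by gcongr <;> exact min_le_left _ _) (H x y)

section
variable {V W : Type*} [AddCommGroup V] [Module ℝ V] [MeasureSpace V]
  [AddCommGroup W] [Module ℝ W] [MeasureSpace W]

/-- Slices over x, y and their midpoint satisfy the hypothesis on W, so the partial integrals
satisfy it on V. -/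
theorem PrekopaLeindler.prod [SFinite (volume : Measure W)] (hV : PrekopaLeindler V)
    (hW : PrekopaLeindler W) : PrekopaLeindler (V × W) := by
  intro f g h hf hg hh H
  rw [Measure.volume_eq_prod, lintegral_prod _ hf.aemeasurable, lintegral_prod _ hg.aemeasurable,
    lintegral_prod _ hh.aemeasurable]
  refine hV _ _ _ hf.lintegral_prod_right' hg.lintegral_prod_right' hh.lintegral_prod_right' ?_
  intro x y
  exact hW _ _ _ (hf.comp measurable_prodMk_left) (hg.comp measurable_prodMk_left)
    (hh.comp measurable_prodMk_left) fun z w => H (x, z) (y, w)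

theorem PrekopaLeindler.congr (hV : PrekopaLeindler V) (e : V ≃ᵐ W) (he : MeasurePreserving e)
    (hadd : ∀ x y, e ((2⁻¹ : ℝ) • (x + y)) = (2⁻¹ : ℝ) • (e x + e y)) : PrekopaLeindler W := by
  intro f g h hf hg hh H
  rw [← he.lintegral_comp hf, ← he.lintegral_comp hg, ← he.lintegral_comp hh]
  refine hV _ _ _ (hf.comp e.measurable) (hg.comp e.measurable) (hh.comp e.measurable) ?_
  intro x y
  rw [hadd]
  exact H _ _

end

theorem prekopaLeindler_pi (n : ℕ) : PrekopaLeindler (Fin n → ℝ) := by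
  induction n with
  | zero =>
    intro f g h _ _ _ H
    -- On a one-point space of mass 1 the integrals are values.
    have := H default default
    simp only [lintegral_unique, volume_pi, Measure.pi_univ, Finset.univ_eq_empty,
      Finset.prod_empty, mul_one]
    convert this
  | succ n ih =>
    refine (prekopaLeindler_real.prod ih).congr
      (MeasurableEquiv.piFinSuccAbove (fun _ => ℝ) 0).symm
      (volume_preserving_piFinSuccAbove (fun _ => ℝ) 0).symm ?_
    rintro ⟨a, x⟩ ⟨b, y⟩
    ext i
    refine Fin.cases ?_ (fun j => ?_) i <;> simp [MeasurableEquiv.piFinSuccAbove, mul_add]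

/-- The Prékopa–Leindler inequality on Euclidean space. -/
theorem prekopaLeindler_euclideanSpace (n : ℕ) : PrekopaLeindler (EuclideanSpace ℝ (Fin n)) :=
  (prekopaLeindler_pi n).congr (MeasurableEquiv.toLp 2 (Fin n → ℝ))
    (PiLp.volume_preserving_toLp (Fin n)) fun x y => by ext i; simp

/-! ### Eigenvalues and quadratic forms -/

section Eigenvalues
variable {d : ℕ} {M : Matrix (Fin d) (Fin d) ℝ}

theorem finite_eigenvalueSet (M : Matrix (Fin d) (Fin d) ℝ) : (eigenvalueSet M).Finite :=
  Module.End.finite_hasEigenvalue _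

theorem mem_eigenvalueSet_iff {l : ℝ} : l ∈ eigenvalueSet M ↔ l ∈ spectrum ℝ M := by
  rw [← Matrix.spectrum_toLin']
  exact Module.End.hasEigenvalue_iff_mem_spectrum

/-- M - l has nonnegative spectrum, hence is positive semidefinite. -/
theorem mul_dotProduct_le_of_le_eigenvalues (hM : M.IsHermitian) {l : ℝ}
    (hl : ∀ r ∈ eigenvalueSet M, l ≤ r) (u : Fin d → ℝ) : l * (u ⬝ᵥ u) ≤ u ⬝ᵥ M *ᵥ u := by
  have hA : (M - algebraMap ℝ _ l).IsHermitian :=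
    hM.sub (by simp [Matrix.IsHermitian, Matrix.algebraMap_eq_diagonal])
  have hpos : (M - algebraMap ℝ _ l).PosSemidef := by
    rw [hA.posSemidef_iff_eigenvalues_nonneg]
    intro i
    have h1 := hA.eigenvalues_mem_spectrum_real i
    rw [← spectrum.sub_singleton_eq, mem_sub] at h1
    obtain ⟨r, hr, s, hs, hrs⟩ := h1
    have := hl r (mem_eigenvalueSet_iff.mpr hr)
    rw [mem_singleton_iff] at hs
    simp only [Pi.zero_apply]
    linarith
  have := hpos.dotProduct_mulVec_nonneg u
  simp only [star_trivial, Matrix.sub_mulVec, dotProduct_sub, Algebra.algebraMap_eq_smul_one,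
    Matrix.smul_mulVec, Matrix.one_mulVec, dotProduct_smul, smul_eq_mul] at this
  linarith

theorem lambdaMin_mul_dotProduct_le (hM : M.IsHermitian) (u : Fin d → ℝ) :
    lambdaMin M * (u ⬝ᵥ u) ≤ u ⬝ᵥ M *ᵥ u :=
  mul_dotProduct_le_of_le_eigenvalues hM
    (fun _ hr => csInf_le (finite_eigenvalueSet M).bddBelow hr) u

theorem dotProduct_mulVec_le_lambdaMax_mul (hM : M.IsHermitian) (u : Fin d → ℝ) :
    u ⬝ᵥ M *ᵥ u ≤ lambdaMax M * (u ⬝ᵥ u) := by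
  have := mul_dotProduct_le_of_le_eigenvalues hM.neg (l := -lambdaMax M) (fun r hr => by
    rw [mem_eigenvalueSet_iff, ← spectrum.neg_eq, Set.mem_neg] at hr
    have := le_csSup (finite_eigenvalueSet M).bddAbove (mem_eigenvalueSet_iff.mpr hr)
    unfold lambdaMax
    linarith) u
  simp only [Matrix.neg_mulVec, dotProduct_neg] at this
  linarith

end Eigenvalues

/-! ### From the covariance matrix to moment bounds -/

/-- `f` is an upper semi-continuous log-concave probability density with mean `m`, whose variance
in every direction is at least `l` and whose covariance has trace at most `d * L`. -/
structure HasMomentBounds {d : ℕ} (f : EuclideanSpace ℝ (Fin d) → ℝ)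
    (m : EuclideanSpace ℝ (Fin d)) (l L : ℝ) : Prop where
  isLogConcave : IsLogConcave f
  upperSemicontinuous : UpperSemicontinuous f
  integrable : Integrable f
  integral_eq_one : ∫ x, f x = 1
  integrable_norm_sq : Integrable fun x => ‖x - m‖ ^ 2 * f x
  integral_inner : ∀ u : EuclideanSpace ℝ (Fin d), ∫ x, ⟪u, x - m⟫ * f x = 0
  le_integral_inner_sq : ∀ u : EuclideanSpace ℝ (Fin d),
    l * ‖u‖ ^ 2 ≤ ∫ x, ⟪u, x - m⟫ ^ 2 * f x
  integral_norm_sq_le : ∫ x, ‖x - m‖ ^ 2 * f x ≤ d * L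

theorem isHermitian_covMatrix {d : ℕ} (f : EuclideanSpace ℝ (Fin d) → ℝ) :
    (covMatrix f).IsHermitian := by
  ext i j
  simp only [covMatrix, Matrix.conjTranspose_apply, Matrix.of_apply, star_trivial]
  exact integral_congr_ae (ae_of_all _ fun x => by ring)

/-- If `f` and `‖x - m‖ ^ 2 * f` are integrable then so is everything of quadratic growth
times `f`. -/
theorem integrable_mul_of_abs_le_norm_sq {d : ℕ} {f : EuclideanSpace ℝ (Fin d) → ℝ}
    {m : EuclideanSpace ℝ (Fin d)} (hf0 : ∀ x, 0 ≤ f x) (hf : Integrable f)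
    (hf2 : Integrable fun x => ‖x - m‖ ^ 2 * f x) {φ : EuclideanSpace ℝ (Fin d) → ℝ}
    (hφ : Measurable φ) (C : ℝ) (h : ∀ x, |φ x| ≤ C * (1 + ‖x - m‖ ^ 2)) :
    Integrable fun x => φ x * f x := by
  refine ((hf.add hf2).const_mul C).mono' (hφ.aestronglyMeasurable.mul hf.1)
    (ae_of_all _ fun x => ?_)
  simp only [Real.norm_eq_abs, abs_mul, abs_of_nonneg (hf0 x), Pi.add_apply]
  calc |φ x| * f x ≤ C * (1 + ‖x - m‖ ^ 2) * f x := by gcongr; exacts [hf0 x, h x]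
    _ = _ := by ring

theorem hasMomentBounds_of_mem_nearIsotropic {d : ℕ} {ξ η : ℝ} (hη : η < 1)
    {f : EuclideanSpace ℝ (Fin d) → ℝ} (hf : f ∈ nearIsotropic d ξ η) :
    HasMomentBounds f (mean f) (1 - η) (1 + η) := by
  obtain ⟨⟨hlc, husc, hint, hone⟩, -, hmin, hmax⟩ := hf
  set m := mean f with hm
  have hH := isHermitian_covMatrix f
  have hdot : ∀ i, (covMatrix f) i i = Pi.single i 1 ⬝ᵥ (covMatrix f) *ᵥ Pi.single i 1 := by
    intro i; simp
  have hdiag : ∀ i, (covMatrix f) i i = ∫ x, (x i - m i) * (x i - m i) * f x := fun i => rfl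
  have hdiag_pos : ∀ i, 0 < (covMatrix f) i i := by
    intro i
    have := lambdaMin_mul_dotProduct_le hH (Pi.single i 1)
    rw [← hdot] at this
    simp only [single_one_dotProduct, Pi.single_eq_same, mul_one] at this
    linarith
  have hdiag_int : ∀ i, Integrable fun x : EuclideanSpace ℝ (Fin d) =>
      (x i - m i) * (x i - m i) * f x := by
    intro i
    -- A divergent integral has the default value 0, which the positive lower bound on the diagonal
    -- entries excludes. Finiteness of second moments thus comes from λ_min > 0.
    by_contra h
    have := hdiag_pos i
    rw [hdiag, integral_undef h] at this
    exact lt_irrefl _ this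
  have hsum : ∀ x : EuclideanSpace ℝ (Fin d),
      ‖x - m‖ ^ 2 * f x = ∑ i, (x i - m i) * (x i - m i) * f x := by
    intro x
    rw [EuclideanSpace.real_norm_sq_eq, Finset.sum_mul]
    simp [sq]
  have hsq : Integrable fun x => ‖x - m‖ ^ 2 * f x := by
    simp_rw [hsum]
    exact integrable_finsetSum _ fun i _ => hdiag_int i
  have habs : ∀ (x : EuclideanSpace ℝ (Fin d)) i, |x i - m i| ≤ ‖x - m‖ := fun x i => by
    simpa using PiLp.norm_apply_le (x - m) i
  have hij : ∀ i j, Integrable fun x : EuclideanSpace ℝ (Fin d) =>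
      (x i - m i) * (x j - m j) * f x := by
    intro i j
    refine integrable_mul_of_abs_le_norm_sq (m := m) hlc.1 hint hsq (by fun_prop) 1 fun x => ?_
    rw [abs_mul]
    have := mul_le_mul (habs x i) (habs x j) (abs_nonneg _) (norm_nonneg _)
    nlinarith
  have hvec : Integrable fun x => f x • x := by
    refine ((hint.add hsq).add (hint.const_mul ‖m‖)).mono' ?_ (ae_of_all _ fun x => ?_)
    · exact hint.1.smul continuous_id.aestronglyMeasurable
    · have h0 := hlc.1 x
      rw [norm_smul, Real.norm_of_nonneg h0]
      have h1 : ‖x‖ ≤ ‖x - m‖ + ‖m‖ := by simpa using norm_add_le (x - m) m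
      have h2 : ‖x - m‖ ≤ 1 + ‖x - m‖ ^ 2 := by nlinarith [sq_nonneg (‖x - m‖ - 1)]
      simp only [Pi.add_apply]
      nlinarith
  have hvec' : Integrable fun x => f x • (x - m) := by
    simp_rw [smul_sub]
    exact hvec.sub (hint.smul_const m)
  refine ⟨hlc, husc, hint, hone, hsq, ?_, ?_, ?_⟩
  · intro u
    have h1 : ∫ x, f x • (x - m) = 0 := by
      simp_rw [smul_sub]
      rw [integral_sub hvec (hint.smul_const m), integral_smul_const, hone, one_smul, hm, mean,
        sub_self]
    have h2 := integral_inner (𝕜 := ℝ) hvec' u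
    rw [h1, inner_zero_right] at h2
    rw [← h2]
    simp only [real_inner_smul_right, mul_comm]
  · intro u
    have h1 := lambdaMin_mul_dotProduct_le hH u.ofLp
    have h2 : u.ofLp ⬝ᵥ u.ofLp = ‖u‖ ^ 2 := by
      rw [EuclideanSpace.real_norm_sq_eq, dotProduct]; simp [sq]
    have h3 : u.ofLp ⬝ᵥ covMatrix f *ᵥ u.ofLp = ∫ x, ⟪u, x - m⟫ ^ 2 * f x := by
      have : ∀ x : EuclideanSpace ℝ (Fin d), ⟪u, x - m⟫ ^ 2 * f x =
          ∑ i, ∑ j, (u i * u j) * ((x i - m i) * (x j - m j) * f x) := by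
        intro x
        rw [PiLp.inner_apply, sq, Finset.sum_mul_sum, Finset.sum_mul]
        refine Finset.sum_congr rfl fun i _ => ?_
        rw [Finset.sum_mul]
        refine Finset.sum_congr rfl fun j _ => ?_
        simp
        ring
      simp_rw [this]
      rw [integral_finsetSum _ fun i _ => integrable_finsetSum _ fun j _ => (hij i j).const_mul _]
      simp only [dotProduct, Matrix.mulVec]
      refine Finset.sum_congr rfl fun i _ => ?_
      rw [integral_finsetSum _ fun j _ => (hij i j).const_mul _, Finset.mul_sum]
      refine Finset.sum_congr rfl fun j _ => ?_
      rw [integral_const_mul]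
      simp only [covMatrix, Matrix.of_apply, hm]
      ring
    rw [← h3]
    rw [h2] at h1
    exact (mul_le_mul_of_nonneg_right hmin (sq_nonneg _)).trans h1
  · simp_rw [hsum]
    rw [integral_finsetSum _ fun i _ => hdiag_int i]
    calc ∑ i, ∫ x : EuclideanSpace ℝ (Fin d), (x i - m i) * (x i - m i) * f x
        ≤ ∑ _i : Fin d, (1 + η) := by
          refine Finset.sum_le_sum fun i _ => ?_
          rw [← hdiag, hdot]
          refine (dotProduct_mulVec_le_lambdaMax_mul hH _).trans ?_
          simpa using hmax
      _ = _ := by simp [mul_add]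

/-! ### Uniform upper bound -/

variable {d : ℕ}

theorem IsLogConcave.mul_le_sq_midpoint {f : EuclideanSpace ℝ (Fin d) → ℝ} (hf : IsLogConcave f)
    (x y : EuclideanSpace ℝ (Fin d)) : f x * f y ≤ f ((2⁻¹ : ℝ) • (x + y)) ^ 2 := by
  have h := hf.2 x y 2⁻¹ 2⁻¹ (by norm_num) (by norm_num) (by norm_num)
  rw [← Real.mul_rpow (hf.1 x) (hf.1 y), ← smul_add] at h
  have h0 := mul_nonneg (hf.1 x) (hf.1 y)
  calc f x * f y = ((f x * f y) ^ (2⁻¹ : ℝ)) ^ 2 := by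
        rw [← Real.rpow_natCast, ← Real.rpow_mul h0]; norm_num
    _ ≤ _ := by gcongr

theorem IsLogConcave.convex_superlevel {f : EuclideanSpace ℝ (Fin d) → ℝ} (hf : IsLogConcave f)
    {r : ℝ} (hr : 0 < r) : Convex ℝ {x | r ≤ f x} := by
  rw [convex_iff_forall_pos]
  intro x hx y hy a b ha hb hab
  calc r = r ^ a * r ^ b := by rw [← Real.rpow_add hr, hab, Real.rpow_one]
    _ ≤ f x ^ a * f y ^ b := by
      have h1 := Real.rpow_le_rpow hr.le hx ha.le
      have h2 := Real.rpow_le_rpow hr.le hy hb.le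
      gcongr
      exact Real.rpow_nonneg (hf.1 x) _
    _ ≤ _ := hf.2 x y a b ha hb hab

theorem integral_comp_smul_add (F : EuclideanSpace ℝ (Fin d) → ℝ) {R : ℝ} (hR : 0 < R)
    (b : EuclideanSpace ℝ (Fin d)) : ∫ x, F (R • x + b) = (R ^ d)⁻¹ * ∫ x, F x := by
  rw [Measure.integral_comp_smul volume (fun x => F (x + b)) R, integral_add_right_eq_self]
  rw [finrank_euclideanSpace_fin, abs_of_nonneg (by positivity), smul_eq_mul]

theorem integrable_comp_smul_add {F : EuclideanSpace ℝ (Fin d) → ℝ} (hF : Integrable F) {R : ℝ}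
    (hR : 0 < R) (b : EuclideanSpace ℝ (Fin d)) : Integrable fun x => F (R • x + b) :=
  (integrable_comp_smul_iff volume (fun x => F (x + b)) hR.ne').mpr (hF.comp_add_right b)

/-- If a linear functional centred at `x₀` is bounded by `δ` on the superlevel set of `f` at a
fixed fraction of `f x₀`, then its second moment is at most `8 δ²`. -/
theorem integral_inner_sq_le_of_abs_le_on_superlevel {f : EuclideanSpace ℝ (Fin d) → ℝ}
    (hlc : IsLogConcave f) (hint : Integrable f) (hone : ∫ x, f x = 1)
    {x₀ : EuclideanSpace ℝ (Fin d)} (hx₀ : 0 < f x₀) (u : EuclideanSpace ℝ (Fin d))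
    (hI : Integrable fun x => ⟪u, x - x₀⟫ ^ 2 * f x) {δ : ℝ}
    (hδ : ∀ x, (2 ^ (d + 3))⁻¹ * f x₀ ≤ f x → |⟪u, x - x₀⟫| ≤ δ) :
    ∫ x, ⟪u, x - x₀⟫ ^ 2 * f x ≤ 8 * δ ^ 2 := by
  set s : ℝ := (2 ^ (d + 3))⁻¹ with hs
  set G : EuclideanSpace ℝ (Fin d) → ℝ := fun x => ⟪u, x - x₀⟫ ^ 2 * f x with hG
  have hGint := integrable_comp_smul_add hI (R := 2⁻¹) (by norm_num) ((2⁻¹ : ℝ) • x₀)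
  have hGval := integral_comp_smul_add G (R := 2⁻¹) (by norm_num) ((2⁻¹ : ℝ) • x₀)
  -- Compare x with the midpoint z of x and x₀. Either z is in the superlevel set, so the functional
  -- at x is at most 2δ, or f x₀ * f x ≤ f z ^ 2 forces f x ≤ s * f z.
  have hpt : ∀ x, G x ≤ 4 * δ ^ 2 * f x + 4 * s * G ((2⁻¹ : ℝ) • x + (2⁻¹ : ℝ) • x₀) := by
    intro x
    set z := (2⁻¹ : ℝ) • x + (2⁻¹ : ℝ) • x₀ with hz
    have hlin : ⟪u, x - x₀⟫ = 2 * ⟪u, z - x₀⟫ := by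
      rw [← real_inner_smul_right]
      congr 1
      rw [hz]
      module
    have hmid := hlc.mul_le_sq_midpoint x x₀
    rw [smul_add, ← hz] at hmid
    have h0 := hlc.1 x
    have h0z := hlc.1 z
    have hs0 : 0 < s := by positivity
    simp only [hG, hlin]
    by_cases hcase : s * f x₀ ≤ f z
    · have h1 : ⟪u, z - x₀⟫ ^ 2 ≤ δ ^ 2 := sq_le_sq.mpr ((hδ z hcase).trans (le_abs_self δ))
      have h2 : 0 ≤ 4 * s * (⟪u, z - x₀⟫ ^ 2 * f z) := by positivity
      have h3 : ⟪u, z - x₀⟫ ^ 2 * f x ≤ δ ^ 2 * f x := by gcongr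
      linarith
    · have h1 : f x ≤ s * f z := by
        have : f x * f x₀ ≤ (s * f z) * f x₀ := by
          push Not at hcase
          nlinarith
        exact le_of_mul_le_mul_right this hx₀
      have h2 : ⟪u, z - x₀⟫ ^ 2 * f x ≤ ⟪u, z - x₀⟫ ^ 2 * (s * f z) := by gcongr
      have h3 : 0 ≤ 4 * δ ^ 2 * f x := by positivity
      linarith
  have hle := integral_mono hI ((hint.const_mul (4 * δ ^ 2)).add (hGint.const_mul (4 * s))) hpt
  simp only [Pi.add_apply] at hle
  rw [integral_add (hint.const_mul _) (hGint.const_mul _), integral_const_mul, integral_const_mul,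
    hone, hGval] at hle
  -- The choice s = 2^(-(d+3)) beats the Jacobian 2^d and the factor 4 by one half, so the last term
  -- is absorbed on the left.
  have hss : 4 * s * ((2⁻¹ ^ d)⁻¹ * ∫ x, G x) = (∫ x, G x) / 2 := by
    have : (2 : ℝ) ^ d ≠ 0 := by positivity
    rw [hs, inv_pow, inv_inv, pow_add]
    field_simp
    norm_num
  rw [hss] at hle
  change ∫ x, G x ≤ 8 * δ ^ 2
  linarith

/-- Greedy choice: u k is a unit vector orthogonal to the earlier v j, which span dimension less
than d, and v k is then a point of S far out along u k. This makes the matrix of the ⟪u i, v j⟫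
triangular. -/
theorem exists_adapted_sequences {S : Set (EuclideanSpace ℝ (Fin d))} {δ : ℝ}
    (h : ∀ u : EuclideanSpace ℝ (Fin d), ‖u‖ = 1 → ∃ v ∈ S, δ ≤ |⟪u, v⟫|) (k : ℕ) (hk : k ≤ d) :
    ∃ u v : ℕ → EuclideanSpace ℝ (Fin d), ∀ i < k, ‖u i‖ = 1 ∧ v i ∈ S ∧ δ ≤ |⟪u i, v i⟫| ∧
      ∀ j < i, ⟪u i, v j⟫ = 0 := by
  induction k with
  | zero => exact ⟨0, 0, by simp⟩
  | succ k ih =>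
    obtain ⟨u, v, huv⟩ := ih (by omega)
    set W : Submodule ℝ (EuclideanSpace ℝ (Fin d)) :=
      Submodule.span ℝ (((Finset.range k).image v : Finset _) : Set _) with hW
    have hWk : Module.finrank ℝ W ≤ k :=
      (finrank_span_finset_le_card _).trans (Finset.card_image_le.trans (by simp))
    have hWo : Wᗮ ≠ ⊥ := by
      intro hbot
      have := Submodule.finrank_add_finrank_orthogonal W
      rw [hbot, finrank_bot, finrank_euclideanSpace_fin] at this
      omega
    obtain ⟨w, hw, hw0⟩ := Submodule.exists_mem_ne_zero_of_ne_bot hWo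
    have hnorm : ‖(‖w‖⁻¹ : ℝ) • w‖ = 1 := norm_smul_inv_norm (𝕜 := ℝ) hw0
    have horth : ∀ j < k, ⟪(‖w‖⁻¹ : ℝ) • w, v j⟫ = 0 := by
      intro j hj
      rw [real_inner_smul_left, Submodule.inner_left_of_mem_orthogonal (K := W)
        (Submodule.subset_span (by simpa using ⟨j, hj, rfl⟩)) hw, mul_zero]
    obtain ⟨v', hv'S, hv'⟩ := h _ hnorm
    refine ⟨Function.update u k ((‖w‖⁻¹ : ℝ) • w), Function.update v k v', fun i hi => ?_⟩
    rcases Nat.lt_succ_iff_lt_or_eq.mp hi with hik | rfl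
    · obtain ⟨h1, h2, h3, h4⟩ := huv i hik
      rw [Function.update_of_ne hik.ne, Function.update_of_ne hik.ne]
      refine ⟨h1, h2, h3, fun j hj => ?_⟩
      rw [Function.update_of_ne (hj.trans hik).ne]
      exact h4 j hj
    · rw [Function.update_self, Function.update_self]
      refine ⟨hnorm, hv'S, hv', fun j hj => ?_⟩
      rw [Function.update_of_ne hj.ne]
      exact horth j hj

/-- A set that is wide in every direction contains vectors spanning a large parallelepiped. -/
theorem exists_det_ge {S : Set (EuclideanSpace ℝ (Fin d))} {δ : ℝ} (hδ : 0 ≤ δ)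
    (h : ∀ u : EuclideanSpace ℝ (Fin d), ‖u‖ = 1 → ∃ v ∈ S, δ ≤ |⟪u, v⟫|) :
    ∃ v : Fin d → EuclideanSpace ℝ (Fin d), (∀ i, v i ∈ S) ∧
      δ ^ d ≤ d.factorial * |(Matrix.of fun i j => v j i).det| := by
  obtain ⟨u, v, huv⟩ := exists_adapted_sequences h d le_rfl
  refine ⟨fun i => v i, fun i => (huv i i.2).2.1, ?_⟩
  set V : Matrix (Fin d) (Fin d) ℝ := Matrix.of fun i j => v j i with hV
  set U : Matrix (Fin d) (Fin d) ℝ := Matrix.of fun i j => u i j with hU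
  have hUV : ∀ i j, (U * V) i j = ⟪u i, v j⟫ := by
    intro i j
    rw [Matrix.mul_apply, PiLp.inner_apply]
    simp [hU, hV, mul_comm]
  have htri : (U * V).IsUpperTriangular := by
    intro i j hij
    rw [hUV]
    exact (huv i i.2).2.2.2 j hij
  have hdet : (U * V).det = ∏ i : Fin d, ⟪u i, v i⟫ := by
    rw [Matrix.det_of_isUpperTriangular htri]
    exact Finset.prod_congr rfl fun i _ => hUV i i
  have hlow : δ ^ d ≤ |(U * V).det| := by
    rw [hdet, Finset.abs_prod]
    calc δ ^ d = ∏ _i : Fin d, δ := by simp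
      _ ≤ _ := Finset.prod_le_prod (fun _ _ => hδ) fun i _ => (huv i i.2).2.2.1
  -- Entries of unit vectors are at most 1, so the Leibniz expansion gives d!.
  have hUdet : |U.det| ≤ d.factorial := by
    have := Matrix.det_le (A := U) (abv := AbsoluteValue.abs) (x := (1 : ℝ)) (by
      intro i j
      have := PiLp.norm_apply_le (u i) j
      rw [(huv i i.2).1] at this
      simpa [hU] using this)
    simpa using this
  rw [Matrix.det_mul, abs_mul] at hlow
  exact hlow.trans (by gcongr)

/-- The leftover weight 1 - ∑ c i goes to x₀. -/
theorem sum_smul_mem_of_convex {ι E : Type*} [AddCommGroup E] [Module ℝ E] {K : Set E}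
    (hK : Convex ℝ K) (t : Finset ι) (v : ι → E) (c : ι → ℝ) {x₀ : E} (hx₀ : x₀ ∈ K)
    (hv : ∀ i ∈ t, x₀ + v i ∈ K) (hc : ∀ i ∈ t, 0 ≤ c i) (hc1 : ∑ i ∈ t, c i ≤ 1) :
    x₀ + ∑ i ∈ t, c i • v i ∈ K := by
  rcases (Finset.sum_nonneg hc).eq_or_lt with h0 | h0
  · have : ∀ i ∈ t, c i • v i = 0 := fun i hi => by
      rw [(Finset.sum_eq_zero_iff_of_nonneg hc).mp h0.symm i hi, zero_smul]
    rw [Finset.sum_eq_zero this, add_zero]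
    exact hx₀
  · have hcm := hK.centerMass_mem hc h0 hv
    have := hK hx₀ hcm (sub_nonneg.mpr hc1) h0.le (by ring)
    convert this using 1
    rw [Finset.centerMass, smul_inv_smul₀ h0.ne']
    simp only [smul_add, Finset.sum_add_distrib, ← Finset.sum_smul]
    module

/-- The volume of a convex set is bounded below by the determinant of the edge vectors at one
of its points. -/
theorem det_le_volume_of_convex {K : Set (EuclideanSpace ℝ (Fin d))}
    (hK : Convex ℝ K) {x₀ : EuclideanSpace ℝ (Fin d)} (hx₀ : x₀ ∈ K)
    (v : Fin d → EuclideanSpace ℝ (Fin d)) (hv : ∀ i, x₀ + v i ∈ K) :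
    ENNReal.ofReal (|(Matrix.of fun i j => v j i).det| * ((d : ℝ)⁻¹) ^ d) ≤ volume K := by
  set V : Matrix (Fin d) (Fin d) ℝ := Matrix.of fun i j => v j i with hV
  -- Coordinates in [0, 1/d] sum to at most 1, so x₀ plus the image of this cube stays in K.
  set Q : Set (EuclideanSpace ℝ (Fin d)) :=
    WithLp.ofLp ⁻¹' Icc (0 : Fin d → ℝ) (fun _ => (d : ℝ)⁻¹) with hQ
  set T := Matrix.toLpLin 2 2 V with hT
  have hTdet : LinearMap.det T = V.det := by
    exact LinearMap.det_toLpLin 2 V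
  have hTapp : ∀ c : EuclideanSpace ℝ (Fin d), T c = ∑ j, c j • v j := by
    intro c
    ext i
    simp [hT, hV, Matrix.toLpLin_apply, Matrix.mulVec, dotProduct, mul_comm]
  have hQvol : volume Q = ENNReal.ofReal (((d : ℝ)⁻¹) ^ d) := by
    rw [hQ, (PiLp.volume_preserving_ofLp (Fin d)).measure_preimage
      measurableSet_Icc.nullMeasurableSet, Real.volume_Icc_pi]
    rw [ENNReal.ofReal_pow (by positivity)]
    simp
  rw [ENNReal.ofReal_mul (abs_nonneg _), ← hTdet, ← hQvol, ← Measure.addHaar_image_linearMap,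
    ← measure_preimage_add volume (-x₀)]
  refine measure_mono fun z hz => ?_
  obtain ⟨c, hc, hcz⟩ := hz
  have hz' : z = x₀ + ∑ j, c j • v j := by
    rw [← hTapp, hcz]; simp
  rw [hz']
  refine sum_smul_mem_of_convex hK _ _ _ hx₀ (fun i _ => hv i) (fun i _ => hc.1 i) ?_
  calc ∑ i, c i ≤ ∑ _i : Fin d, (d : ℝ)⁻¹ := Finset.sum_le_sum fun i _ => hc.2 i
    _ ≤ 1 := by simpa using mul_inv_le_one

theorem HasMomentBounds.integrable_mul {f : EuclideanSpace ℝ (Fin d) → ℝ}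
    {m : EuclideanSpace ℝ (Fin d)} {l L : ℝ} (hf : HasMomentBounds f m l L)
    {φ : EuclideanSpace ℝ (Fin d) → ℝ} (hφ : Measurable φ) (C : ℝ)
    (h : ∀ x, |φ x| ≤ C * (1 + ‖x - m‖ ^ 2)) : Integrable fun x => φ x * f x :=
  integrable_mul_of_abs_le_norm_sq hf.isLogConcave.1 hf.integrable hf.integrable_norm_sq hφ C h

theorem HasMomentBounds.integrable_inner {f : EuclideanSpace ℝ (Fin d) → ℝ}
    {m : EuclideanSpace ℝ (Fin d)} {l L : ℝ} (hf : HasMomentBounds f m l L)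
    (u : EuclideanSpace ℝ (Fin d)) : Integrable fun x => ⟪u, x - m⟫ * f x := by
  refine hf.integrable_mul (by fun_prop) ‖u‖ fun x => ?_
  refine (abs_real_inner_le_norm _ _).trans ?_
  gcongr
  nlinarith [sq_nonneg (‖x - m‖ - 1)]

theorem HasMomentBounds.integrable_inner_sq {f : EuclideanSpace ℝ (Fin d) → ℝ}
    {m : EuclideanSpace ℝ (Fin d)} {l L : ℝ} (hf : HasMomentBounds f m l L)
    (u : EuclideanSpace ℝ (Fin d)) : Integrable fun x => ⟪u, x - m⟫ ^ 2 * f x := by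
  refine hf.integrable_mul (by fun_prop) (‖u‖ ^ 2) fun x => ?_
  rw [abs_pow]
  calc |⟪u, x - m⟫| ^ 2 ≤ (‖u‖ * ‖x - m‖) ^ 2 := by
        gcongr; exact abs_real_inner_le_norm _ _
    _ ≤ _ := by rw [mul_pow]; gcongr; linarith

theorem HasMomentBounds.integrable_inner_add_sq {f : EuclideanSpace ℝ (Fin d) → ℝ}
    {m : EuclideanSpace ℝ (Fin d)} {l L : ℝ} (hf : HasMomentBounds f m l L)
    (u : EuclideanSpace ℝ (Fin d)) (c : ℝ) :
    Integrable fun x => (⟪u, x - m⟫ + c) ^ 2 * f x := by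
  have := ((hf.integrable_inner_sq u).add ((hf.integrable_inner u).const_mul (2 * c))).add
    (hf.integrable.const_mul (c ^ 2))
  refine this.congr (ae_of_all _ fun x => ?_)
  simp only [Pi.add_apply]
  ring

/-- The cross term vanishes because m is the mean. -/
theorem HasMomentBounds.le_integral_inner_add_sq {f : EuclideanSpace ℝ (Fin d) → ℝ}
    {m : EuclideanSpace ℝ (Fin d)} {l L : ℝ} (hf : HasMomentBounds f m l L)
    (u : EuclideanSpace ℝ (Fin d)) (c : ℝ) :
    l * ‖u‖ ^ 2 + c ^ 2 ≤ ∫ x, (⟪u, x - m⟫ + c) ^ 2 * f x := by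
  have : ∀ x, (⟪u, x - m⟫ + c) ^ 2 * f x =
      ⟪u, x - m⟫ ^ 2 * f x + (2 * c) * (⟪u, x - m⟫ * f x) + c ^ 2 * f x := fun x => by ring
  have h1 := (hf.integrable_inner u).const_mul (2 * c)
  have h2 : Integrable fun x => ⟪u, x - m⟫ ^ 2 * f x + (2 * c) * (⟪u, x - m⟫ * f x) :=
    (hf.integrable_inner_sq u).add h1
  simp_rw [this]
  rw [integral_add h2 (hf.integrable.const_mul _), integral_add (hf.integrable_inner_sq u) h1, integral_const_mul, integral_const_mul,
    hf.integral_inner, hf.integral_eq_one]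
  linarith [hf.le_integral_inner_sq u]

/-- A dimensional constant bounding `f` times the square root of the determinant of its
covariance. -/
noncomputable def supConst (d : ℕ) : ℝ := 2 ^ (d + 3) * d.factorial * d ^ d * 3 ^ d

/-- A log-concave density with variance at least `ρ ^ 2` in every direction is bounded by a
dimensional multiple of `ρ ^ (-d)`. -/
theorem HasMomentBounds.le_supConst {f : EuclideanSpace ℝ (Fin d) → ℝ}
    {m : EuclideanSpace ℝ (Fin d)} {ρ L : ℝ} (hd : 1 ≤ d) (hρ : 0 < ρ)
    (hf : HasMomentBounds f m (ρ ^ 2) L) (x₀ : EuclideanSpace ℝ (Fin d)) :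
    f x₀ * ρ ^ d ≤ supConst d := by
  rcases (hf.isLogConcave.1 x₀).eq_or_lt with h0 | h0
  · rw [← h0, zero_mul, supConst]; positivity
  set s : ℝ := (2 ^ (d + 3))⁻¹ with hs
  have hs0 : 0 < s := by positivity
  have hs1 : s ≤ 1 := inv_le_one_of_one_le₀ (one_le_pow₀ (by norm_num))
  have hwide : ∀ u : EuclideanSpace ℝ (Fin d), ‖u‖ = 1 →
      ∃ v ∈ {v | s * f x₀ ≤ f (x₀ + v)}, ρ / 3 ≤ |⟪u, v⟫| := by
    intro u hu
    by_contra! hcon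
    have hshift : ∀ x, ⟪u, x - x₀⟫ = ⟪u, x - m⟫ + ⟪u, m - x₀⟫ := fun x => by
      rw [← inner_add_right]; congr 1; abel
    have hI := hf.integrable_inner_add_sq u ⟪u, m - x₀⟫
    have hlow := hf.le_integral_inner_add_sq u ⟪u, m - x₀⟫
    simp_rw [← hshift] at hI hlow
    -- The contradiction is 8 (ρ/3)² < ρ².
    have hup := integral_inner_sq_le_of_abs_le_on_superlevel hf.isLogConcave hf.integrable
      hf.integral_eq_one h0 u hI (δ := ρ / 3) (fun x hx =>
        (hcon (x - x₀) (by simpa using hx)).le)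
    rw [hu] at hlow
    nlinarith [sq_nonneg ⟪u, m - x₀⟫]
  obtain ⟨v, hv, hdet⟩ := exists_det_ge (by positivity) hwide
  have hvol := det_le_volume_of_convex (hf.isLogConcave.convex_superlevel (mul_pos hs0 h0))
    (x₀ := x₀) (by simpa using mul_le_of_le_one_left h0.le hs1) v hv
  set D := |(Matrix.of fun i j => v j i).det|
  have hmarkov := mul_meas_ge_le_integral_of_nonneg (ae_of_all _ hf.isLogConcave.1) hf.integrable
    (s * f x₀)
  have hfin : volume {x | s * f x₀ ≤ f x} ≠ ∞ :=
    (hf.integrable.measure_ge_lt_top (mul_pos hs0 h0)).ne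
  have hvol' : D * ((d : ℝ)⁻¹) ^ d ≤ volume.real {x | s * f x₀ ≤ f x} :=
    (ENNReal.ofReal_le_iff_le_toReal hfin).mp hvol
  rw [hf.integral_eq_one] at hmarkov
  have hd0 : (0 : ℝ) < d := by exact_mod_cast hd
  have h1 : s * f x₀ * (D * ((d : ℝ)⁻¹) ^ d) ≤ 1 :=
    (mul_le_mul_of_nonneg_left hvol' (by positivity)).trans hmarkov
  have h2 : f x₀ * D ≤ 2 ^ (d + 3) * d ^ d := by
    rw [hs, inv_pow] at h1
    field_simp at h1
    linarith
  rw [div_pow, div_le_iff₀ (by positivity)] at hdet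
  calc f x₀ * ρ ^ d ≤ f x₀ * (d.factorial * D * 3 ^ d) := by gcongr
    _ = d.factorial * 3 ^ d * (f x₀ * D) := by ring
    _ ≤ d.factorial * 3 ^ d * (2 ^ (d + 3) * d ^ d) := by gcongr
    _ = _ := by rw [supConst]; ring

/-! ### Exponential decay -/

theorem HasMomentBounds.integral_indicator_compl_ball_le {f : EuclideanSpace ℝ (Fin d) → ℝ}
    {m : EuclideanSpace ℝ (Fin d)} {l L R : ℝ} (hf : HasMomentBounds f m l L) (hR : 0 < R)
    (hL : 4 * (d * L) ≤ R ^ 2) : ∫ x, (Metric.ball m R)ᶜ.indicator f x ≤ 1 / 4 := by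
  have hmeas : MeasurableSet (Metric.ball m R)ᶜ := Metric.isOpen_ball.measurableSet.compl
  have h1 : ∫ x, (R ^ 2) * (Metric.ball m R)ᶜ.indicator f x ≤ ∫ x, ‖x - m‖ ^ 2 * f x := by
    refine integral_mono ((hf.integrable.indicator hmeas).const_mul _) hf.integrable_norm_sq
      fun x => ?_
    have h0 := hf.isLogConcave.1 x
    by_cases hx : x ∈ (Metric.ball m R)ᶜ
    · simp only [indicator_of_mem hx]
      have : R ≤ ‖x - m‖ := by simpa [dist_eq_norm] using hx
      gcongr
    · simp only [indicator_of_notMem hx, mul_zero]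
      positivity
  rw [integral_const_mul] at h1
  have h2 := h1.trans hf.integral_norm_sq_le
  have : R ^ 2 * ∫ x, (Metric.ball m R)ᶜ.indicator f x ≤ R ^ 2 * (1 / 4) := by linarith
  exact le_of_mul_le_mul_left this (by positivity)

/-- The map x ↦ (1 - t)x + ty sends the ball, of mass at least 3/4, into its complement, of mass at
most 1/4. Since f ≤ M, log-concavity gives f ≥ q f(x) at the image of x. Integrating, with Jacobian
factor at most 3/2, gives (3/4) q ≤ 3/8. -/
theorem HasMomentBounds.div_rpow_le_half {f : EuclideanSpace ℝ (Fin d) → ℝ}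
    {m : EuclideanSpace ℝ (Fin d)} {l L R M : ℝ} (hf : HasMomentBounds f m l L) (hR : 0 < R)
    (hL : 4 * (d * L) ≤ R ^ 2) (hM : 0 < M) (hfM : ∀ x, f x ≤ M) {y : EuclideanSpace ℝ (Fin d)}
    {t : ℝ} (ht : 0 < t) (ht1 : t < 1) (htd : 3 * (d * t) ≤ 1) (hy : 2 * R ≤ t * ‖y - m‖) :
    (f y / M) ^ t ≤ 1 / 2 := by
  set q := (f y / M) ^ t with hq
  have hq0 : 0 ≤ q := Real.rpow_nonneg (div_nonneg (hf.isLogConcave.1 y) hM.le) _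
  have hmeas : MeasurableSet (Metric.ball m R) := Metric.isOpen_ball.measurableSet
  have ht' : 0 < 1 - t := by linarith
  have hcompl := hf.integral_indicator_compl_ball_le hR hL
  have hball : 3 / 4 ≤ ∫ x, (Metric.ball m R).indicator f x := by
    have := integral_add (hf.integrable.indicator hmeas) (hf.integrable.indicator hmeas.compl)
    have h2 : ∀ x, (Metric.ball m R).indicator f x + (Metric.ball m R)ᶜ.indicator f x = f x :=
      fun x => congrFun (indicator_self_add_compl (Metric.ball m R) f) x
    simp_rw [h2] at this
    rw [hf.integral_eq_one] at this
    linarith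
  have hpt : ∀ x, q * (Metric.ball m R).indicator f x ≤
      (Metric.ball m R)ᶜ.indicator f ((1 - t) • x + t • y) := by
    intro x
    by_cases hx : x ∈ Metric.ball m R
    · have hxR : ‖x - m‖ < R := by simpa [dist_eq_norm] using hx
      have hmem : (1 - t) • x + t • y ∈ (Metric.ball m R)ᶜ := by
        simp only [mem_compl_iff, Metric.mem_ball, dist_eq_norm, not_lt]
        have e : (1 - t) • x + t • y - m = t • (y - m) - (1 - t) • (m - x) := by module
        have h1 := norm_sub_norm_le (t • (y - m)) ((1 - t) • (m - x))
        rw [← e, norm_smul, norm_smul, Real.norm_of_nonneg ht.le, Real.norm_of_nonneg ht'.le,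
          norm_sub_rev m x] at h1
        nlinarith [norm_nonneg (x - m)]
      rw [indicator_of_mem hx, indicator_of_mem hmem]
      refine le_trans ?_ (hf.isLogConcave.2 x y (1 - t) t ht' ht (by ring))
      rcases (hf.isLogConcave.1 x).eq_or_lt with h0 | h0
      · rw [← h0, mul_zero, Real.zero_rpow ht'.ne', zero_mul]
      · have hx1 : f x = f x ^ (1 - t) * f x ^ t := by
          rw [← Real.rpow_add h0]; simp
        have hx2 : f x ^ t ≤ M ^ t := Real.rpow_le_rpow h0.le (hfM x) ht.le
        have hMt : 0 < M ^ t := Real.rpow_pos_of_pos hM t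
        have hyt : 0 ≤ f y ^ t := Real.rpow_nonneg (hf.isLogConcave.1 y) t
        have hxt : 0 ≤ f x ^ (1 - t) := Real.rpow_nonneg h0.le _
        rw [hq, Real.div_rpow (hf.isLogConcave.1 y) hM.le]
        calc f y ^ t / M ^ t * f x = f y ^ t / M ^ t * (f x ^ (1 - t) * f x ^ t) := by rw [← hx1]
          _ ≤ f y ^ t / M ^ t * (f x ^ (1 - t) * M ^ t) := by gcongr
          _ = f x ^ (1 - t) * f y ^ t := by field_simp
    · rw [indicator_of_notMem hx, mul_zero]
      exact indicator_nonneg (fun z _ => hf.isLogConcave.1 z) _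
  have hint := integral_mono ((hf.integrable.indicator hmeas).const_mul q)
    (integrable_comp_smul_add (hf.integrable.indicator hmeas.compl) ht' (t • y)) hpt
  rw [integral_const_mul, integral_comp_smul_add _ ht'] at hint
  have hpow : 2 / 3 ≤ (1 - t) ^ d := by
    have := one_add_mul_le_pow (a := -t) (by linarith) d
    rw [← sub_eq_add_neg] at this
    linarith
  have hinv : ((1 - t) ^ d)⁻¹ ≤ 3 / 2 := by
    rw [inv_le_comm₀ (by positivity) (by norm_num)]
    norm_num
    exact hpow
  have h1 : ((1 - t) ^ d)⁻¹ * ∫ x, (Metric.ball m R)ᶜ.indicator f x ≤ 3 / 2 * (1 / 4) := by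
    have : 0 ≤ ∫ x, (Metric.ball m R)ᶜ.indicator f x :=
      integral_nonneg (indicator_nonneg fun z _ => hf.isLogConcave.1 z)
    gcongr
  nlinarith

/-- A bounded log-concave density decays exponentially away from its mean, at a rate governed
by its covariance. -/
theorem HasMomentBounds.le_mul_exp {f : EuclideanSpace ℝ (Fin d) → ℝ}
    {m : EuclideanSpace ℝ (Fin d)} {l σ M : ℝ} (hd : 1 ≤ d) (hσ : 0 < σ)
    (hf : HasMomentBounds f m l (σ ^ 2)) (hM : 0 < M) (hfM : ∀ x, f x ≤ M)
    (y : EuclideanSpace ℝ (Fin d)) :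
    f y ≤ M * Real.exp (-(Real.log 2 / (4 * √d) * ‖y - m‖ / σ) + 3 * d * Real.log 2) := by
  have hd1 : (1 : ℝ) ≤ d := by exact_mod_cast hd
  have hsd : 0 < √(d : ℝ) := Real.sqrt_pos.mpr (by linarith)
  have hlog : 0 < Real.log 2 := Real.log_pos (by norm_num)
  set R := 2 * σ * √d with hR
  have hR0 : 0 < R := by positivity
  have hL : 4 * (d * σ ^ 2) ≤ R ^ 2 := by
    rw [hR, mul_pow, Real.sq_sqrt (by linarith)]; linarith
  set r := ‖y - m‖ with hr
  have hexp : Real.log 2 / (4 * √d) * r / σ = Real.log 2 * (r / (2 * R)) := by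
    rw [hR]; field_simp; ring
  rw [hexp]
  -- With t = 2R/r this threshold is exactly 3dt ≤ 1. Below it the term 3d log 2 makes the exponent
  -- nonnegative, and f ≤ M suffices.
  by_cases hbig : 6 * d * R ≤ r
  · have hr0 : 0 < r := lt_of_lt_of_le (by positivity) hbig
    have ht : 0 < 2 * R / r := by positivity
    have htd : 3 * (d * (2 * R / r)) ≤ 1 := by
      rw [show 3 * (d * (2 * R / r)) = 6 * d * R / r by ring, div_le_one hr0]
      exact hbig
    have hhalf := hf.div_rpow_le_half hR0 hL hM hfM (y := y) ht (by nlinarith) htd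
      (by rw [← hr]; field_simp; exact le_refl _)
    rcases (hf.isLogConcave.1 y).eq_or_lt with h0 | h0
    · rw [← h0]; positivity
    have hq : 0 < f y / M := by positivity
    have h1 := Real.log_le_log (Real.rpow_pos_of_pos hq _) hhalf
    rw [Real.log_rpow hq, one_div, Real.log_inv] at h1
    have h2 : Real.log (f y / M) ≤ -(Real.log 2 * (r / (2 * R))) := by
      have : Real.log (f y / M) = (2 * R / r * Real.log (f y / M)) * (r / (2 * R)) := by
        field_simp
      rw [this, ← neg_mul]
      gcongr
    calc f y = M * Real.exp (Real.log (f y / M)) := by rw [Real.exp_log hq]; field_simp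
      _ ≤ _ := by
        gcongr
        have : 0 ≤ 3 * d * Real.log 2 := by positivity
        linarith
  · push Not at hbig
    refine (hfM y).trans (le_mul_of_one_le_right hM.le (Real.one_le_exp ?_))
    have h1 : r / (2 * R) ≤ 3 * d := by
      rw [div_le_iff₀ (by positivity)]; linarith
    nlinarith

/-! ### Reverse Hölder and the mass of half-spaces -/

theorem integral_mul_integral_le_sq {f g h : EuclideanSpace ℝ (Fin d) → ℝ}
    (hf : Measurable f) (hg : Measurable g) (hh : Measurable h) (hf0 : 0 ≤ f) (hg0 : 0 ≤ g)
    (hh0 : 0 ≤ h) (hfi : Integrable f) (hgi : Integrable g) (hhi : Integrable h)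
    (H : ∀ x y, f x * g y ≤ h ((2⁻¹ : ℝ) • (x + y)) ^ 2) :
    (∫ x, f x) * ∫ x, g x ≤ (∫ x, h x) ^ 2 := by
  have key := prekopaLeindler_euclideanSpace d (fun x => ENNReal.ofReal (f x))
    (fun x => ENNReal.ofReal (g x)) (fun x => ENNReal.ofReal (h x)) hf.ennreal_ofReal
    hg.ennreal_ofReal hh.ennreal_ofReal fun x y => by
      rw [← ENNReal.ofReal_mul (hf0 x), ← ENNReal.ofReal_pow (hh0 _)]
      exact ENNReal.ofReal_le_ofReal (H x y)
  rw [← ofReal_integral_eq_lintegral_ofReal hfi (ae_of_all _ hf0),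
    ← ofReal_integral_eq_lintegral_ofReal hgi (ae_of_all _ hg0),
    ← ofReal_integral_eq_lintegral_ofReal hhi (ae_of_all _ hh0),
    ← ENNReal.ofReal_mul (integral_nonneg hf0), ← ENNReal.ofReal_pow (integral_nonneg hh0)] at key
  exact (ENNReal.ofReal_le_ofReal_iff (by positivity)).mp key

/-- Reverse Hölder inequality for the positive part of an affine functional `φ` under a
log-concave weight. -/
theorem integral_mul_integral_posPart_sq_le {f φ : EuclideanSpace ℝ (Fin d) → ℝ}
    (hlc : IsLogConcave f) (hf : Measurable f) (hφ : Measurable φ)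
    (hφmid : ∀ x y, φ ((2⁻¹ : ℝ) • (x + y)) = 2⁻¹ * (φ x + φ y))
    (h0 : Integrable f) (h1 : Integrable fun x => max (φ x) 0 * f x)
    (h2 : Integrable fun x => max (φ x) 0 ^ 2 * f x) :
    (∫ x, {x | 0 < φ x}.indicator f x) * ∫ x, max (φ x) 0 ^ 2 * f x ≤
      4 * (∫ x, max (φ x) 0 * f x) ^ 2 := by
  have hmeas : MeasurableSet {x | 0 < φ x} := measurableSet_lt measurable_const hφ
  have hf0 := hlc.1
  have key := integral_mul_integral_le_sq (f := {x | 0 < φ x}.indicator f)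
    (g := fun x => max (φ x) 0 ^ 2 * f x) (h := fun x => 2 * (max (φ x) 0 * f x))
    (hf.indicator hmeas) (((hφ.max measurable_const).pow_const 2).mul hf)
    (((hφ.max measurable_const).mul hf).const_mul 2)
    (indicator_nonneg fun x _ => hf0 x) (fun x => mul_nonneg (sq_nonneg _) (hf0 x))
    (fun x => mul_nonneg zero_le_two (mul_nonneg (le_max_right _ _) (hf0 x)))
    (h0.indicator hmeas) h2 (h1.const_mul 2) (fun x y => by
      by_cases hx : 0 < φ x
      · rw [indicator_of_mem (show x ∈ {x | 0 < φ x} from hx)]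
        -- Since φ x > 0, the midpoint value exceeds half of φ y; this is the source of the factor 2
        -- in h.
        have hmax : max (φ y) 0 ≤ 2 * max (φ ((2⁻¹ : ℝ) • (x + y))) 0 := by
          rw [hφmid]
          refine max_le ?_ (by positivity)
          linarith [le_max_left (2⁻¹ * (φ x + φ y)) 0]
        have hmid := hlc.mul_le_sq_midpoint x y
        calc f x * (max (φ y) 0 ^ 2 * f y) = max (φ y) 0 ^ 2 * (f x * f y) := by ring
          _ ≤ (2 * max (φ ((2⁻¹ : ℝ) • (x + y))) 0) ^ 2 * f ((2⁻¹ : ℝ) • (x + y)) ^ 2 := by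
            gcongr
            exact mul_nonneg (hf0 x) (hf0 y)
          _ = _ := by ring
      · rw [indicator_of_notMem (show x ∉ {x | 0 < φ x} from hx), zero_mul]
        positivity)
  rw [integral_const_mul] at key
  linarith [key]

/-- A log-concave density whose variance in the direction `u` is at least `ρ ^ 2` keeps a definite
part of its second moment in the half-space `ρ / 4 ≤ ⟪u, x - m⟫`. -/
theorem HasMomentBounds.lt_integral_halfspace {f : EuclideanSpace ℝ (Fin d) → ℝ}
    {m u : EuclideanSpace ℝ (Fin d)} {ρ L κ : ℝ} (hρ : 0 < ρ)
    (hf : HasMomentBounds f m (ρ ^ 2) L) (hu : ‖u‖ = 1) (hκ1 : κ ≤ 1 / 2) (hκ2 : κ ≤ ρ / 20)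
    (hκ3 : κ ≤ ρ ^ 2 / 4) :
    κ < ∫ x, {x | ρ / 4 ≤ ⟪u, x - m⟫}.indicator (fun x => (1 + ‖x - m‖ ^ 2) * f x) x := by
  by_contra! hcon
  set a := ρ / 4 with ha
  set T : Set (EuclideanSpace ℝ (Fin d)) := {x | a ≤ ⟪u, x - m⟫} with hT
  have hTm : MeasurableSet T := measurableSet_le measurable_const (by fun_prop)
  -- The weight 1 + ‖x - m‖² dominates the error made on T in the mass, the first moment and the
  -- second moment alike.
  set tail : EuclideanSpace ℝ (Fin d) → ℝ :=
    T.indicator (fun x => (1 + ‖x - m‖ ^ 2) * f x) with htail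
  set φ : EuclideanSpace ℝ (Fin d) → ℝ := fun x => a - ⟪u, x - m⟫ with hφ
  have hf0 := hf.isLogConcave.1
  have hfm : Measurable f := hf.upperSemicontinuous.measurable
  have hφm : Measurable φ := by fun_prop
  have htaili : Integrable tail := by
    refine Integrable.indicator (hf.integrable_mul (by fun_prop) 1 fun x => ?_) hTm
    rw [abs_of_nonneg (by positivity), one_mul]
  have htailT : ∀ x ∈ T, tail x = (1 + ‖x - m‖ ^ 2) * f x := fun x hx => indicator_of_mem hx _
  have htailT' : ∀ x ∉ T, tail x = 0 := fun x hx => indicator_of_notMem hx _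
  have hYle : ∀ x, |⟪u, x - m⟫| ≤ ‖x - m‖ := fun x => by
    simpa [hu] using abs_real_inner_le_norm u (x - m)
  have hmaxle : ∀ x, max (φ x) 0 ≤ a + ‖x - m‖ := fun x =>
    max_le (by have := neg_le_of_abs_le (hYle x); simp only [hφ]; linarith) (by positivity)
  have hi1 : Integrable fun x => max (φ x) 0 * f x := by
    refine hf.integrable_mul (hφm.max measurable_const) (a + 1) fun x => ?_
    rw [abs_of_nonneg (le_max_right _ _)]
    refine (hmaxle x).trans ?_
    have ha0 : 0 < a := by positivity
    nlinarith [sq_nonneg (‖x - m‖ - 1), mul_nonneg ha0.le (sq_nonneg ‖x - m‖)]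
  have hi2 : Integrable fun x => max (φ x) 0 ^ 2 * f x := by
    refine hf.integrable_mul ((hφm.max measurable_const).pow_const 2) (2 * a ^ 2 + 2) fun x => ?_
    rw [abs_of_nonneg (sq_nonneg _)]
    calc max (φ x) 0 ^ 2 ≤ (a + ‖x - m‖) ^ 2 := by gcongr; exact hmaxle x
      _ ≤ _ := by nlinarith [sq_nonneg (a - ‖x - m‖), mul_nonneg (sq_nonneg a) (sq_nonneg ‖x - m‖)]
  have hpos : {x | 0 < φ x} = Tᶜ := by
    ext x; simp [hφ, hT]
  have hrev := integral_mul_integral_posPart_sq_le hf.isLogConcave hfm hφm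
    (fun x y => by
      have : (2⁻¹ : ℝ) • (x + y) - m = (2⁻¹ : ℝ) • ((x - m) + (y - m)) := by module
      simp only [hφ, this, real_inner_smul_right, inner_add_right]
      ring) hf.integrable hi1 hi2
  rw [hpos] at hrev
  have hmass : 1 - κ ≤ ∫ x, Tᶜ.indicator f x := by
    have : ∫ x, f x ≤ ∫ x, (Tᶜ.indicator f x + tail x) := by
      refine integral_mono hf.integrable ((hf.integrable.indicator hTm.compl).add htaili)
        fun x => ?_
      by_cases hx : x ∈ T
      · rw [indicator_of_notMem (by simpa using hx), htailT x hx]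
        nlinarith [hf0 x, mul_nonneg (sq_nonneg ‖x - m‖) (hf0 x)]
      · rw [indicator_of_mem (by simpa using hx), htailT' x hx, add_zero]
    rw [integral_add (hf.integrable.indicator hTm.compl) htaili, hf.integral_eq_one] at this
    linarith
  have hfirst : ∫ x, max (φ x) 0 * f x ≤ a + κ := by
    have h1 : Integrable fun x => a * f x - ⟪u, x - m⟫ * f x :=
      (hf.integrable.const_mul a).sub (hf.integrable_inner u)
    have : ∫ x, max (φ x) 0 * f x ≤ ∫ x, ((a * f x - ⟪u, x - m⟫ * f x) + tail x) := by
      refine integral_mono hi1 (h1.add htaili) fun x => ?_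
      by_cases hx : x ∈ T
      · have hx' : a ≤ ⟪u, x - m⟫ := hx
        have h2 : max (φ x) 0 = 0 := max_eq_right (by simp only [hφ]; linarith)
        simp only [h2, zero_mul]
        rw [htailT x hx]
        have h3 := (le_abs_self _).trans (hYle x)
        have h4 : 0 ≤ a - ⟪u, x - m⟫ + (1 + ‖x - m‖ ^ 2) := by
          have : 0 < a := by positivity
          nlinarith [sq_nonneg (‖x - m‖ - 1)]
        nlinarith [mul_nonneg h4 (hf0 x)]
      · have hx' : ⟪u, x - m⟫ < a := not_le.mp hx
        have h2 : max (φ x) 0 = φ x := max_eq_left (by simp only [hφ]; linarith)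
        simp only [h2]
        rw [htailT' x hx]
        simp only [hφ]
        linarith
    rw [integral_add h1 htaili, integral_sub (hf.integrable.const_mul a) (hf.integrable_inner u),
      integral_const_mul, hf.integral_eq_one, hf.integral_inner] at this
    linarith
  have hsecond : ρ ^ 2 + a ^ 2 - κ ≤ ∫ x, max (φ x) 0 ^ 2 * f x := by
    have hlow := hf.le_integral_inner_add_sq u (-a)
    have : ∫ x, (⟪u, x - m⟫ + -a) ^ 2 * f x ≤ ∫ x, (max (φ x) 0 ^ 2 * f x + tail x) := by
      refine integral_mono (hf.integrable_inner_add_sq u (-a)) (hi2.add htaili) fun x => ?_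
      by_cases hx : x ∈ T
      · have hx' : a ≤ ⟪u, x - m⟫ := hx
        have h2 : max (φ x) 0 = 0 := max_eq_right (by simp only [hφ]; linarith)
        simp only [h2]
        rw [htailT x hx]
        have h3 := (le_abs_self _).trans (hYle x)
        have ha0 : 0 < a := by positivity
        have h4 : (⟪u, x - m⟫ + -a) ^ 2 ≤ 1 + ‖x - m‖ ^ 2 := by nlinarith
        have := mul_le_mul_of_nonneg_right h4 (hf0 x)
        linarith
      · have hx' : ⟪u, x - m⟫ < a := not_le.mp hx
        have h2 : max (φ x) 0 = φ x := max_eq_left (by simp only [hφ]; linarith)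
        simp only [h2]
        rw [htailT' x hx]
        simp only [hφ]
        apply le_of_eq
        ring
    rw [integral_add hi2 htaili] at this
    rw [hu] at hlow
    linarith
  have hfirst0 : 0 ≤ ∫ x, max (φ x) 0 * f x :=
    integral_nonneg fun x => mul_nonneg (le_max_right _ _) (hf0 x)
  set E1 := ∫ x, max (φ x) 0 * f x
  have hE1 : E1 ≤ 3 / 10 * ρ := by rw [ha] at hfirst; linarith
  have hS : 13 / 16 * ρ ^ 2 ≤ ∫ x, max (φ x) 0 ^ 2 * f x := by
    refine le_trans ?_ hsecond
    rw [ha]; linarith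
  have hP : 1 / 2 ≤ ∫ x, Tᶜ.indicator f x := by linarith
  -- The three bounds on κ leave (1/2)(13/16) ρ² = 0.40625 ρ² against 4 (3/10)² ρ² = 0.36 ρ².
  have h1 := mul_le_mul hP hS (by positivity) (by linarith)
  have h2 : E1 ^ 2 ≤ (3 / 10 * ρ) ^ 2 := by gcongr
  have h3 : 0 < ρ ^ 2 := by positivity
  linarith

theorem integrable_one_add_sq_mul_exp_neg_norm {b : ℝ} (hb : 0 < b) :
    Integrable fun x : EuclideanSpace ℝ (Fin d) => (1 + ‖x‖ ^ 2) * Real.exp (-(b * ‖x‖)) := by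
  have hbase := (integrable_one_add_norm (E := EuclideanSpace ℝ (Fin d)) (μ := volume)
    (r := (d + 1 : ℕ)) (by simp)).const_mul ((d + 3).factorial * (b ^ (d + 3))⁻¹ * Real.exp b)
  refine hbase.mono' (by fun_prop) (ae_of_all _ fun x => ?_)
  have hx := norm_nonneg x
  rw [Real.norm_of_nonneg (by positivity), Real.rpow_neg (by positivity), Real.rpow_natCast]
  -- Of the d + 3 powers, two absorb the quadratic factor and d + 1 give integrability.
  have h1 := Real.pow_div_factorial_le_exp (x := b * (1 + ‖x‖)) (by positivity) (d + 3)
  rw [mul_add, mul_one, Real.exp_add, div_le_iff₀ (by positivity)] at h1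
  have h2 : (b + b * ‖x‖) ^ (d + 3) = b ^ (d + 3) * (1 + ‖x‖) ^ (d + 3) := by
    rw [← mul_pow]; ring
  rw [h2] at h1
  have h3 : 1 + ‖x‖ ^ 2 ≤ (1 + ‖x‖) ^ 2 := by nlinarith
  rw [Real.exp_neg]
  have hp : (1 + ‖x‖) ^ (d + 3) = (1 + ‖x‖) ^ 2 * (1 + ‖x‖) ^ (d + 1) := by ring
  rw [hp] at h1
  rw [← div_eq_mul_inv, ← div_eq_mul_inv, div_le_div_iff₀ (by positivity) (by positivity)]
  have hbp : 0 < b ^ (d + 3) := by positivity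
  rw [← div_eq_mul_inv, div_mul_eq_mul_div, div_mul_eq_mul_div, le_div_iff₀ hbp]
  calc (1 + ‖x‖ ^ 2) * (1 + ‖x‖) ^ (d + 1) * b ^ (d + 3)
      ≤ (1 + ‖x‖) ^ 2 * (1 + ‖x‖) ^ (d + 1) * b ^ (d + 3) := by gcongr
    _ = b ^ (d + 3) * ((1 + ‖x‖) ^ 2 * (1 + ‖x‖) ^ (d + 1)) := by ring
    _ ≤ _ := h1
    _ = _ := by ring

/-! ### Separation and uniform positivity -/

/-- A closed superlevel set missing `x` is missed by a half-space whose boundary contains `x`. -/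
theorem exists_unit_forall_lt_of_lt {f : EuclideanSpace ℝ (Fin d) → ℝ} (hd : 1 ≤ d)
    (hlc : IsLogConcave f) (husc : UpperSemicontinuous f) {ε : ℝ} (hε : 0 < ε)
    {x : EuclideanSpace ℝ (Fin d)} (hx : f x < ε) :
    ∃ u : EuclideanSpace ℝ (Fin d), ‖u‖ = 1 ∧ ∀ z, ⟪u, x⟫ ≤ ⟪u, z⟫ → f z < ε := by
  obtain ⟨g, s, hgx, hg⟩ := geometric_hahn_banach_point_closed (hlc.convex_superlevel hε)
    (husc.isClosed_preimage ε) (not_le.mpr hx)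
  set w := (InnerProductSpace.toDual ℝ (EuclideanSpace ℝ (Fin d))).symm g
  have hw : ∀ z, ⟪w, z⟫ = g z := fun z => InnerProductSpace.toDual_symm_apply
  -- Here the superlevel set is empty, and any unit vector serves.
  by_cases hw0 : w = 0
  · refine ⟨EuclideanSpace.single ⟨0, hd⟩ 1, by simp, fun z _ => ?_⟩
    by_contra! hz
    have h1 := hg z hz
    rw [← hw, hw0, inner_zero_left] at h1 hgx
    linarith
  · have hwn : 0 < ‖w‖ := norm_pos_iff.mpr hw0
    refine ⟨-((‖w‖⁻¹ : ℝ) • w), by rw [norm_neg]; exact norm_smul_inv_norm (𝕜 := ℝ) hw0,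
      fun z hz => ?_⟩
    by_contra! hz'
    have h1 := hg z hz'
    rw [inner_neg_left, inner_neg_left, real_inner_smul_left, real_inner_smul_left, hw, hw,
      neg_le_neg_iff] at hz
    have := le_of_mul_le_mul_left hz (inv_pos.mpr hwn)
    linarith

/-- The geometric mean of the two bounds keeps both smallness and decay, at half the rate. -/
theorem le_mul_exp_of_le_sq_div {v c K b r : ℝ} (hK : 0 < K) (hc : 0 ≤ c) (hv : 0 ≤ v)
    (h1 : v ≤ c ^ 2 / K) (h2 : v ≤ K * Real.exp (-(2 * b * r))) :
    v ≤ c * Real.exp (-(b * r)) := by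
  refine (sq_le_sq₀ hv (by positivity)).mp ?_
  calc v ^ 2 = v * v := sq _
    _ ≤ c ^ 2 / K * (K * Real.exp (-(2 * b * r))) := by gcongr
    _ = c ^ 2 * Real.exp (-(2 * b * r)) := by field_simp
    _ = (c * Real.exp (-(b * r))) ^ 2 := by
      rw [mul_pow, ← Real.exp_nat_mul]
      push_cast
      ring_nf

/-- If `f` has an exponential envelope and is small on a set `T`, then so is its second moment
over `T`. -/
theorem HasMomentBounds.integral_indicator_le {f : EuclideanSpace ℝ (Fin d) → ℝ}
    {m : EuclideanSpace ℝ (Fin d)} {l L c K b : ℝ} (hf : HasMomentBounds f m l L) (hK : 0 < K)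
    (hb : 0 < b) (hc : 0 ≤ c) (henv : ∀ x, f x ≤ K * Real.exp (-(2 * b * ‖x - m‖)))
    {T : Set (EuclideanSpace ℝ (Fin d))} (hT : MeasurableSet T) (hfT : ∀ x ∈ T, f x ≤ c ^ 2 / K) :
    ∫ x, T.indicator (fun x => (1 + ‖x - m‖ ^ 2) * f x) x ≤
      c * ∫ x : EuclideanSpace ℝ (Fin d), (1 + ‖x‖ ^ 2) * Real.exp (-(b * ‖x‖)) := by
  rw [← integral_sub_right_eq_self
    (fun x : EuclideanSpace ℝ (Fin d) => (1 + ‖x‖ ^ 2) * Real.exp (-(b * ‖x‖))) m,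
    ← integral_const_mul]
  refine integral_mono (Integrable.indicator (hf.integrable_mul (by fun_prop) 1 fun x => ?_) hT)
    (((integrable_one_add_sq_mul_exp_neg_norm hb).comp_sub_right m).const_mul _) fun z => ?_
  · rw [abs_of_nonneg (by positivity), one_mul]
  · by_cases hz : z ∈ T
    · rw [indicator_of_mem hz]
      have := le_mul_exp_of_le_sq_div hK hc (hf.isLogConcave.1 z) (hfT z hz) (henv z)
      calc (1 + ‖z - m‖ ^ 2) * f z
          ≤ (1 + ‖z - m‖ ^ 2) * (c * Real.exp (-(b * ‖z - m‖))) := by gcongr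
        _ = _ := by ring
    · rw [indicator_of_notMem hz]
      positivity

/-- Log-concave densities with exponential envelope and variance at least `ρ ^ 2` in every
direction are uniformly positive within distance `ρ / 4` of the mean. -/
theorem exists_pos_le_of_norm_sub_mean_le (hd : 1 ≤ d) {ρ K b : ℝ} (hρ : 0 < ρ) (hK : 0 < K)
    (hb : 0 < b) : ∃ ε > 0, ∀ (f : EuclideanSpace ℝ (Fin d) → ℝ) (m : EuclideanSpace ℝ (Fin d))
      (L : ℝ), HasMomentBounds f m (ρ ^ 2) L →
      (∀ x, f x ≤ K * Real.exp (-(2 * b * ‖x - m‖))) → ∀ x, ‖x - m‖ ≤ ρ / 4 → ε ≤ f x := by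
  obtain ⟨J, hJ0, hJ⟩ : ∃ J : ℝ, 0 ≤ J ∧
      ∫ x : EuclideanSpace ℝ (Fin d), (1 + ‖x‖ ^ 2) * Real.exp (-(b * ‖x‖)) = J :=
    ⟨_, integral_nonneg fun x => by positivity, rfl⟩
  obtain ⟨κ, hκ0, hκ1, hκ2, hκ3⟩ : ∃ κ > 0, κ ≤ 1 / 2 ∧ κ ≤ ρ / 20 ∧ κ ≤ ρ ^ 2 / 4 :=
    ⟨min (1 / 2) (min (ρ / 20) (ρ ^ 2 / 4)), by positivity, min_le_left _ _,
      (min_le_right _ _).trans (min_le_left _ _), (min_le_right _ _).trans (min_le_right _ _)⟩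
  -- With c = κ/(J + 1) the half-space integral is at most cJ ≤ κ; the level c²/K is what the
  -- geometric mean requires.
  have hc : 0 < κ / (J + 1) := by positivity
  refine ⟨(κ / (J + 1)) ^ 2 / K, by positivity, fun f m L hf henv x hx => ?_⟩
  by_contra! hlt
  obtain ⟨u, hu, hhalf⟩ := exists_unit_forall_lt_of_lt hd hf.isLogConcave hf.upperSemicontinuous
    (by positivity) hlt
  have hlow := hf.lt_integral_halfspace hρ hu hκ1 hκ2 hκ3
  have hup := hf.integral_indicator_le hK hb hc.le henv (T := {x | ρ / 4 ≤ ⟪u, x - m⟫})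
    (measurableSet_le measurable_const (by fun_prop)) fun z (hz : ρ / 4 ≤ ⟪u, z - m⟫) =>
      (hhalf z (by
        have h1 := real_inner_le_norm u (x - m)
        rw [hu, one_mul, inner_sub_right] at h1
        rw [inner_sub_right] at hz
        linarith)).le
  rw [hJ] at hup
  have : κ / (J + 1) * J ≤ κ := by
    rw [div_mul_eq_mul_div, div_le_iff₀ (by positivity)]
    nlinarith
  linarith

/-! ### Assembling both bounds -/

theorem one_le_supConst (hd : 1 ≤ d) : 1 ≤ supConst d := by
  have hd1 : (1 : ℝ) ≤ d := by exact_mod_cast hd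
  have h1 : (1 : ℝ) ≤ d.factorial := by exact_mod_cast Nat.factorial_pos d
  have h2 : (1 : ℝ) ≤ 2 ^ (d + 3) := one_le_pow₀ (by norm_num)
  have h3 : (1 : ℝ) ≤ (d : ℝ) ^ d := one_le_pow₀ hd1
  have h4 : (1 : ℝ) ≤ 3 ^ d := one_le_pow₀ (by norm_num)
  exact one_le_mul_of_one_le_of_one_le
    (one_le_mul_of_one_le_of_one_le (one_le_mul_of_one_le_of_one_le h2 h1) h3) h4

/-- The exponential envelope of a near-isotropic log-concave density, centred at its mean. -/
theorem le_exp_of_mem_nearIsotropic (hd : 1 ≤ d) {ξ η : ℝ} (hη0 : 0 < η) (hη : η < 1)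
    {f : EuclideanSpace ℝ (Fin d) → ℝ} (hf : f ∈ nearIsotropic d ξ η)
    (x : EuclideanSpace ℝ (Fin d)) :
    f x ≤ supConst d * (√(1 - η) ^ d)⁻¹ *
      Real.exp (-(Real.log 2 / (4 * √d) * ‖x - mean f‖ / √(1 + η)) + 3 * d * Real.log 2) := by
  have hρ : 0 < √(1 - η) := Real.sqrt_pos.mpr (by linarith)
  have hσ : 0 < √(1 + η) := Real.sqrt_pos.mpr (by linarith)
  have hC := one_le_supConst hd
  have hm := hasMomentBounds_of_mem_nearIsotropic hη hf
  rw [← Real.sq_sqrt (show 0 ≤ 1 - η by linarith), ← Real.sq_sqrt (show 0 ≤ 1 + η by linarith)]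
    at hm
  refine hm.le_mul_exp hd hσ (by positivity) (fun z => ?_) x
  rw [← div_eq_mul_inv, le_div_iff₀ (by positivity)]
  exact hm.le_supConst hd hρ z

end LogConcaveEnvelope

/-- Suprema and infima over the class are taken in the extended reals, a complete lattice. -/
theorem corollary3p5 (d : ℕ) (hd : 1 ≤ d) :
    (∃ A B : ℝ, 0 < A ∧ 0 < B ∧
      ∀ ξ : ℝ, 0 ≤ ξ → ∀ η : ℝ, 0 < η → η < 1 → ∀ x : EuclideanSpace ℝ (Fin d),
        (⨆ f ∈ LogConcaveEnvelope.nearIsotropic d ξ η, ((f x : ℝ) : EReal)) ≤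
          (((1 - η) ^ (-(d : ℝ) / 2) *
            Real.exp (-(A * ‖x‖ / Real.sqrt (1 + η)) + A * ξ / Real.sqrt (1 + η) + B) : ℝ) :
              EReal)) ∧
    (∀ ξ : ℝ, 0 ≤ ξ → ∀ η : ℝ, 0 < η → η < 1 → ξ < Real.sqrt (1 - η) / 4 →
      ∀ x : EuclideanSpace ℝ (Fin d), ‖x‖ ≤ Real.sqrt (1 - η) / 4 - ξ →
        (0 : EReal) < ⨅ f ∈ LogConcaveEnvelope.nearIsotropic d ξ η, ((f x : ℝ) : EReal)) := by
  have hd0 : (0 : ℝ) < d := by exact_mod_cast hd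
  have hlog : 0 < Real.log 2 := Real.log_pos (by norm_num)
  have hC := LogConcaveEnvelope.one_le_supConst hd
  have hlogC := Real.log_nonneg hC
  have hsd : 0 < √(d : ℝ) := Real.sqrt_pos.mpr hd0
  set A := Real.log 2 / (4 * √d) with hA
  have hA0 : 0 < A := by positivity
  constructor
  · refine ⟨A, Real.log (LogConcaveEnvelope.supConst d) + 3 * d * Real.log 2, hA0, by positivity,
      fun ξ _ η hη0 hη1 x => iSup₂_le fun f hf => EReal.coe_le_coe_iff.mpr ?_⟩
    have hσ : 0 < √(1 + η) := Real.sqrt_pos.mpr (by linarith)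
    have hpow : (1 - η) ^ (-(d : ℝ) / 2) = (√(1 - η) ^ d)⁻¹ := by
      rw [Real.sqrt_eq_rpow, ← Real.rpow_natCast, ← Real.rpow_mul (by linarith),
        ← Real.rpow_neg (by linarith)]
      congr 1
      ring
    have hnorm : ‖x‖ - ξ ≤ ‖x - LogConcaveEnvelope.mean f‖ := by
      linarith [norm_sub_norm_le x (LogConcaveEnvelope.mean f), hf.2.1]
    refine (LogConcaveEnvelope.le_exp_of_mem_nearIsotropic hd hη0 hη1 hf x).trans ?_
    have h1 : A * (‖x‖ - ξ) / √(1 + η) ≤ A * ‖x - LogConcaveEnvelope.mean f‖ / √(1 + η) := by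
      gcongr
    rw [mul_sub, sub_div] at h1
    rw [hpow, mul_comm (LogConcaveEnvelope.supConst d), mul_assoc]
    refine mul_le_mul_of_nonneg_left ?_ (by positivity)
    nth_rw 1 [← Real.exp_log (show 0 < LogConcaveEnvelope.supConst d by linarith)]
    rw [← Real.exp_add, Real.exp_le_exp]
    linarith
  · intro ξ _ η hη0 hη1 _ x hx
    have hρ : 0 < √(1 - η) := Real.sqrt_pos.mpr (by linarith)
    have hσ : 0 < √(1 + η) := Real.sqrt_pos.mpr (by linarith)
    -- K and 2b are read off the exponential envelope, so ε is chosen before f.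
    obtain ⟨ε, hε, hlow⟩ := LogConcaveEnvelope.exists_pos_le_of_norm_sub_mean_le hd hρ
      (K := LogConcaveEnvelope.supConst d * (√(1 - η) ^ d)⁻¹ * Real.exp (3 * d * Real.log 2))
      (b := A / √(1 + η) / 2) (by positivity) (by positivity)
    refine lt_of_lt_of_le (EReal.coe_pos.mpr hε)
      (le_iInf₂ fun f hf => EReal.coe_le_coe_iff.mpr ?_)
    have hm := LogConcaveEnvelope.hasMomentBounds_of_mem_nearIsotropic hη1 hf
    rw [← Real.sq_sqrt (show 0 ≤ 1 - η by linarith)] at hm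
    refine hlow f _ _ hm (fun z => ?_) x ?_
    · refine (LogConcaveEnvelope.le_exp_of_mem_nearIsotropic hd hη0 hη1 hf z).trans_eq ?_
      rw [mul_assoc _ (Real.exp _), ← Real.exp_add, hA]
      congr 2
      ring
    -- ‖x - m‖ ≤ ‖x‖ + ξ ≤ √(1 - η)/4.
    · linarith [norm_sub_le x (LogConcaveEnvelope.mean f), hf.2.1]
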